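/- All Lie algebras are finite-dimensional over $\mathbb C$; omitted brackets of basis vectors are zero (up to antisymmetry). Let $n\ge 3$ and $\alpha_3,\dots,\alpha_{n-1}\in\mathbb C$. Let $L=\mathfrak s^4_{n,1}(\alpha_3,\dots,\alpha_{n-1})$ be the Lie algebra with basis $x,e_1,\dots,e_n$ and $$[e_i,e_1]=e_{i+1}\ (2\le i\le n-1),\qquad [e_i,x]=e_i+\sum_{l=i+2}^{n}\alpha_{l+1-i}e_l\ (2\le i\le n).$$ For even $2m$ let $\tau^3_{2m,1}(\alpha_4,\alpha_6,\dots,\alpha_{2m-2})$ be the Lie algebra with basis $x,e_1,\dots,e_{2m}$ and $$[e_i,e_1]=e_{i+1}\ (2\le i\le 2m-2),\quad [e_i,e_{2m+1-i}]=(-1)^ie_{2m}\ (2\le i\le m),$$ $$[e_i,x]=e_i+\sum_{k\ge 2,\ 2k-1+i\le 2m-1}\alpha_{2k}\,e_{2k-1+i}\ (2\le i\le 2m-1),\quad [e_{2m},x]=2e_{2m}.$$ Let $N=\langle e_1,\dots,e_n\rangle$ be the nilradical of $L$ and $Z(N)$ its center. Let $\theta:L\to\operatorname{End}(\mathbb C)$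 be a representation with $N\subseteq\ker\theta$, and let $\gamma\in\mathbb C$ be the scalar by which $\theta(x)$ acts. For a 2-cocycle $\psi$ of $L$ with values in $(\mathbb C,\theta)$, the one-dimensional extension $L(\psi,\theta)$ is $L\oplus\mathbb C$ with the bracket $$[y+u,z+v]=[y,z]+\psi(y,z)+\theta(y)v-\theta(z)u .$$ It is called non-split if no nonzero $z\in Z(N)$ satisfies $\psi(z,N)=0$. (a) Every non-split one-dimensional extension $L(\psi,\theta)$ satisfies one of the following: (i) $\gamma=-1$ and $L(\psi,\theta)\cong\mathfrak s^4_{n+1,1}(\alpha_3,\dots,\alpha_{n-1},\alpha_n)$ for some $\alpha_n\in\mathbb C$; (ii) $\gamma=-2$, $n$ is odd, $\alpha_{2t-1}=0$ for all $t\ge 2$ with $2t-1\le n-1$, and $L(\psi,\theta)\cong\tau^3_{n+1,1}(\alpha_4,\alpha_6,\dots,\alpha_{n-1})$. (b) For every $\alpha_n\in\mathbb C$ the algebra $\mathfrak s^4_{n+1,1}(\alpha_3,\dots,\alpha_{n-1},\alpha_n)$ is isomorphic to a non-split one-dimensional extension of $L$ with $\gamma=-1$. (c) If $n$ is odd and $\alpha_{2t-1}=0$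 for all $t\ge 2$ with $2t-1\le n-1$, then $\tau^3_{n+1,1}(\alpha_4,\alpha_6,\dots,\alpha_{n-1})$ is isomorphic to a non-split one-dimensional extension of $L$ with $\gamma=-2$. -/

import Mathlib

/-! Lie algebras over `ℂ`: nilradicals, one-dimensional extensions by 2-cocycles, and the
solvable Lie algebras `𝔰⁴_{n,1}(α₃, …, α_{n-1})` and `τ³_{2m,1}(α₄, α₆, …, α_{2m-2})`. -/

attribute [local instance 100] LieRing.ofAssociativeRing

noncomputable section

namespace FiliformExt

section Extensions

variable {L : Type*} [LieRing L] [LieAlgebra ℂ L]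

/-- The nilradical: the largest nilpotent ideal (the sum of all nilpotent ideals). -/
def nilradical (L : Type*) [LieRing L] [LieAlgebra ℂ L] : LieIdeal ℂ L :=
  sSup {I : LieIdeal ℂ L | LieRing.IsNilpotent I}

/-- The one-dimensional space `ℂ` with the `L`-module structure given by the representation
`θ : L → End ℂ`. -/
def RepModule (_θ : L →ₗ⁅ℂ⁆ Module.End ℂ ℂ) : Type := ℂ

variable (θ : L →ₗ⁅ℂ⁆ Module.End ℂ ℂ)

instance : AddCommGroup (RepModule θ) := inferInstanceAs (AddCommGroup ℂ)

instance : Module ℂ (RepModule θ) := inferInstanceAs (Module ℂ ℂ)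

instance : LieRingModule L (RepModule θ) where
  bracket y v := θ y v
  add_lie y z v := by
    have h : ∀ t : ℂ, θ (y + z) t = θ y t + θ z t := fun t => by
      rw [map_add, LinearMap.add_apply]
    exact h v
  lie_add y v w := map_add (θ y) v w
  leibniz_lie y z v := by
    have h : ∀ t : ℂ, θ y (θ z t) = θ ⁅y, z⁆ t + θ z (θ y t) := fun t => by
      rw [LieHom.map_lie, LieRing.of_associative_ring_bracket, LinearMap.sub_apply,
        Module.End.mul_apply, Module.End.mul_apply, sub_add_cancel]
    exact h v

instance : LieModule ℂ L (RepModule θ) where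
  smul_lie t y v := by
    have h : ∀ r : ℂ, θ (t • y) r = t • θ y r := fun r => by
      rw [map_smul, LinearMap.smul_apply]
    exact h v
  lie_smul t y v := map_smul (θ y) t v

/-- `Ann(ψ⁰) ∩ Z(N) = 0`, where `N` is the nilradical of `L`, `Z(N)` its center, and
`ψ⁰ = ψ|_{N × N}`. -/
def IsNonSplit {M : Type*} [AddCommGroup M] [Module ℂ M] [LieRingModule L M] [LieModule ℂ L M]
    (ψ : LieModule.Cohomology.twoCocycle ℂ L M) : Prop :=
  ∀ z ∈ nilradical L, (∀ y ∈ nilradical L, ⁅z, y⁆ = 0) →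
    (∀ y ∈ nilradical L, (ψ : LieModule.Cohomology.twoCochain ℂ L M) z y = 0) → z = 0

end Extensions

section Shift

/-- The vector `e_i` in the space with basis `e_2, …, e_{N+1}` (zero for other indices `i`). -/
def unitVec (N i : ℕ) : Fin N → ℂ := fun k => if (k : ℕ) + 2 = i then 1 else 0

/-- The nilpotent operator `e_2 ↦ e_3 ↦ ⋯ ↦ e_{N+1} ↦ 0`. -/
def shift (N : ℕ) : Module.End ℂ (Fin N → ℂ) where
  toFun v k := if (k : ℕ) = 0 then 0 else v ⟨k - 1, by omega⟩
  map_add' v w := by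
    funext k
    by_cases h : (k : ℕ) = 0 <;> simp [h]
  map_smul' t v := by
    funext k
    by_cases h : (k : ℕ) = 0 <;> simp [h]

theorem shift_unitVec (N i : ℕ) (hi : 2 ≤ i) : shift N (unitVec N i) = unitVec N (i + 1) := by
  funext k
  simp only [shift, unitVec, LinearMap.coe_mk, AddHom.coe_mk]
  split_ifs <;> first | rfl | omega

theorem shift_pow_unitVec (N i m : ℕ) (hi : 2 ≤ i) :
    (shift N ^ m) (unitVec N i) = unitVec N (i + m) := by
  induction m with
  | zero => simp
  | succ m ih =>
    rw [pow_succ', Module.End.mul_apply, ih, shift_unitVec N (i + m) (by omega), add_assoc]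

theorem unitVec_eq_zero (N i : ℕ) (hi : N + 2 ≤ i) : unitVec N i = 0 := by
  funext k
  have := k.2
  simp only [unitVec, Pi.zero_apply]
  rw [if_neg (by omega)]

theorem unitVec_one (N : ℕ) : unitVec N 1 = 0 := by
  funext k
  simp [unitVec]

end Shift

/-! ### The algebras `𝔰⁴_{n,1}(α₃, …, α_{n-1})` -/

section S4

/-- The operator `e_i ↦ [e_i, x] = e_i + ∑_{l = i+2}^{n} α_{l+1-i} e_l` on `⟨e_2, …, e_n⟩`. -/
def s4Op (n : ℕ) (α : ℕ → ℂ) : Module.End ℂ (Fin (n - 1) → ℂ) :=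
  1 + ∑ j ∈ Finset.Icc 3 (n - 1), α j • shift (n - 1) ^ (j - 1)

theorem shift_s4Op (n : ℕ) (α : ℕ → ℂ) (v : Fin (n - 1) → ℂ) :
    shift (n - 1) (s4Op n α v) = s4Op n α (shift (n - 1) v) := by
  have h : Commute (shift (n - 1)) (s4Op n α) :=
    (Commute.one_right _).add_right
      (Commute.sum_right _ _ _ fun j _ => ((Commute.refl _).pow_right _).smul_right _)
  exact congrArg (fun f : Module.End ℂ (Fin (n - 1) → ℂ) => f v) h.eq

/-- The Lie algebra `𝔰⁴_{n,1}(α₃, …, α_{n-1})` with basis `x, e_1, e_2, …, e_n`. The element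
`⟨a, b, v⟩` is `a x + b e_1 + v` with `v ∈ ⟨e_2, …, e_n⟩`. Only the values
`α 3, …, α (n-1)` of `α` matter. -/
@[ext]
structure S4 (n : ℕ) (α : ℕ → ℂ) where
  cx : ℂ
  c1 : ℂ
  v : Fin (n - 1) → ℂ

namespace S4

variable {n : ℕ} {α : ℕ → ℂ}

/-- Coordinates. -/
def equivProd (n : ℕ) (α : ℕ → ℂ) : S4 n α ≃ ℂ × ℂ × (Fin (n - 1) → ℂ) where
  toFun u := (u.cx, u.c1, u.v)
  invFun p := ⟨p.1, p.2.1, p.2.2⟩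

instance : AddCommGroup (S4 n α) := (equivProd n α).addCommGroup

instance : Module ℂ (S4 n α) := (equivProd n α).module ℂ

@[simp] theorem add_cx (u w : S4 n α) : (u + w).cx = u.cx + w.cx := rfl
@[simp] theorem add_c1 (u w : S4 n α) : (u + w).c1 = u.c1 + w.c1 := rfl
@[simp] theorem add_v (u w : S4 n α) : (u + w).v = u.v + w.v := rfl
@[simp] theorem smul_cx (t : ℂ) (u : S4 n α) : (t • u).cx = t * u.cx := rfl
@[simp] theorem smul_c1 (t : ℂ) (u : S4 n α) : (t • u).c1 = t * u.c1 := rfl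
@[simp] theorem smul_v (t : ℂ) (u : S4 n α) : (t • u).v = t • u.v := rfl
@[simp] theorem zero_cx : (0 : S4 n α).cx = 0 := rfl
@[simp] theorem zero_c1 : (0 : S4 n α).c1 = 0 := rfl
@[simp] theorem zero_v : (0 : S4 n α).v = 0 := rfl

instance : Bracket (S4 n α) (S4 n α) where
  bracket u w :=
    { cx := 0
      c1 := 0
      v := w.cx • s4Op n α u.v + w.c1 • shift (n - 1) u.v
        - (u.cx • s4Op n α w.v + u.c1 • shift (n - 1) w.v) }

@[simp] theorem lie_cx (u w : S4 n α) : ⁅u, w⁆.cx = 0 := rfl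
@[simp] theorem lie_c1 (u w : S4 n α) : ⁅u, w⁆.c1 = 0 := rfl
@[simp] theorem lie_v (u w : S4 n α) : ⁅u, w⁆.v =
    w.cx • s4Op n α u.v + w.c1 • shift (n - 1) u.v
      - (u.cx • s4Op n α w.v + u.c1 • shift (n - 1) w.v) := rfl

instance : LieRing (S4 n α) where
  add_lie u v w := by
    refine S4.ext (by simp) (by simp) ?_
    simp only [lie_v, add_cx, add_c1, add_v, map_add]
    module
  lie_add u v w := by
    refine S4.ext (by simp) (by simp) ?_
    simp only [lie_v, add_cx, add_c1, add_v, map_add]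
    module
  lie_self u := S4.ext (by simp) (by simp) (by simp)
  leibniz_lie u v w := by
    refine S4.ext (by simp) (by simp) ?_
    simp only [lie_v, lie_cx, lie_c1, add_v, map_add, map_sub, map_smul, shift_s4Op]
    module

instance : LieAlgebra ℂ (S4 n α) where
  lie_smul t u w := by
    refine S4.ext (by simp) (by simp) ?_
    simp only [lie_v, smul_cx, smul_c1, smul_v, map_smul]
    module

/-- The basis vector `x`. -/
def x : S4 n α := ⟨1, 0, 0⟩

/-- The basis vectors `e_1, …, e_n` (zero for other indices). -/
def e (i : ℕ) : S4 n α := ⟨0, if i = 1 then 1 else 0, unitVec (n - 1) i⟩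

/-! The multiplication table. -/

theorem lie_e_e_one {i : ℕ} (hi : 2 ≤ i) : ⁅(e i : S4 n α), (e 1 : S4 n α)⁆ = e (i + 1) := by
  have h1 : i ≠ 1 := by omega
  have h0 : i ≠ 0 := by omega
  ext1 <;> simp [e, shift_unitVec _ _ hi, h1, h0]

theorem e_last (hn : 2 ≤ n) : (e (n + 1) : S4 n α) = 0 := by
  have h0 : n ≠ 0 := by omega
  ext1 <;> simp [e, h0, unitVec_eq_zero (n - 1) (n + 1) (by omega)]

theorem lie_e_one_x : ⁅(e 1 : S4 n α), (x : S4 n α)⁆ = 0 := by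
  ext1 <;> simp [e, x, unitVec_one]

theorem lie_e_e {i j : ℕ} (hi : 2 ≤ i) (hj : 2 ≤ j) :
    ⁅(e i : S4 n α), (e j : S4 n α)⁆ = 0 := by
  have h1 : i ≠ 1 := by omega
  have h2 : j ≠ 1 := by omega
  ext1 <;> simp [e, h1, h2]

theorem lie_e_x {i : ℕ} (hi : 2 ≤ i) : ⁅(e i : S4 n α), (x : S4 n α)⁆ =
    e i + ∑ l ∈ Finset.Icc (i + 2) n, α (l + 1 - i) • e l := by
  have h1 : ∑ l ∈ Finset.Icc (i + 2) n, α (l + 1 - i) • (e l : S4 n α) =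
      ⟨0, 0, ∑ l ∈ Finset.Icc (i + 2) n, α (l + 1 - i) • unitVec (n - 1) l⟩ := by
    have key : ∀ s : Finset ℕ, (∀ l ∈ s, l ≠ 1) →
        ∑ l ∈ s, α (l + 1 - i) • (e l : S4 n α) =
          ⟨0, 0, ∑ l ∈ s, α (l + 1 - i) • unitVec (n - 1) l⟩ := by
      intro s
      induction s using Finset.induction_on with
      | empty => intro _; rfl
      | insert a s ha ih =>
        intro h
        have ha1 : a ≠ 1 := h a (Finset.mem_insert_self a s)
        rw [Finset.sum_insert ha, Finset.sum_insert ha,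
          ih fun l hl => h l (Finset.mem_insert_of_mem hl)]
        ext1 <;> simp [e, ha1]
    refine key _ fun l hl => ?_
    rw [Finset.mem_Icc] at hl
    omega
  have h2 : ∑ l ∈ Finset.Icc (i + 2) n, α (l + 1 - i) • unitVec (n - 1) l =
      ∑ j ∈ Finset.Icc 3 (n - 1), α j • unitVec (n - 1) (i + (j - 1)) := by
    refine Finset.sum_bij_ne_zero (fun l _ _ => l + 1 - i) ?_ ?_ ?_ ?_
    · intro l hl _
      rw [Finset.mem_Icc] at hl ⊢
      omega
    · intro l hl _ l' hl' _ h
      rw [Finset.mem_Icc] at hl hl'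
      omega
    · intro j hj h0
      rw [Finset.mem_Icc] at hj
      have hle : i + (j - 1) ≤ n := by
        by_contra hcon
        rw [unitVec_eq_zero _ _ (by omega), smul_zero] at h0
        exact h0 rfl
      have hj' : i + (j - 1) + 1 - i = j := by omega
      exact ⟨i + (j - 1), Finset.mem_Icc.2 ⟨by omega, hle⟩, by rwa [hj'], hj'⟩
    · intro l hl _
      rw [Finset.mem_Icc] at hl
      have : i + (l + 1 - i - 1) = l := by omega
      rw [this]
  have h3 : i ≠ 1 := by omega
  rw [h1, h2]
  ext1 <;> simp [e, x, h3, s4Op, LinearMap.sum_apply, shift_pow_unitVec _ _ _ hi]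

end S4

end S4

/-! ### The algebras `τ³_{2m,1}(α₄, α₆, …, α_{2m-2})` -/

section Tau3

/-- The bilinear form with `ω(e_i, e_{N+3-i}) = (-1)^i` for `2 ≤ i ≤ N+1`, all other values on
the basis vectors `e_2, …, e_{N+1}` being zero. -/
def altForm (N : ℕ) (v w : Fin N → ℂ) : ℂ :=
  ∑ k : Fin N, (-1) ^ (k : ℕ) * v k * w k.rev

theorem altForm_add_left (N : ℕ) (u v w : Fin N → ℂ) :
    altForm N (u + v) w = altForm N u w + altForm N v w := by
  simp only [altForm, ← Finset.sum_add_distrib, Pi.add_apply]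
  exact Finset.sum_congr rfl fun k _ => by ring

theorem altForm_add_right (N : ℕ) (u v w : Fin N → ℂ) :
    altForm N u (v + w) = altForm N u v + altForm N u w := by
  simp only [altForm, ← Finset.sum_add_distrib, Pi.add_apply]
  exact Finset.sum_congr rfl fun k _ => by ring

theorem altForm_smul_left (N : ℕ) (t : ℂ) (v w : Fin N → ℂ) :
    altForm N (t • v) w = t * altForm N v w := by
  simp only [altForm, Finset.mul_sum, Pi.smul_apply, smul_eq_mul]
  exact Finset.sum_congr rfl fun k _ => by ring

theorem altForm_smul_right (N : ℕ) (t : ℂ) (v w : Fin N → ℂ) :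
    altForm N v (t • w) = t * altForm N v w := by
  simp only [altForm, Finset.mul_sum, Pi.smul_apply, smul_eq_mul]
  exact Finset.sum_congr rfl fun k _ => by ring

theorem altForm_swap (m : ℕ) (v w : Fin (2 * m - 2) → ℂ) :
    altForm (2 * m - 2) v w = -altForm (2 * m - 2) w v := by
  simp only [altForm, ← Finset.sum_neg_distrib]
  refine Fintype.sum_equiv Fin.revPerm _ _ fun k => ?_
  simp only [Fin.revPerm_apply, Fin.rev_rev]
  have hk := k.2
  have h : ((-1 : ℂ)) ^ (k : ℕ) = -(-1) ^ ((k.rev : Fin (2 * m - 2)) : ℕ) := by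
    rw [Fin.val_rev]
    rcases Nat.even_or_odd (k : ℕ) with he | ho
    · have ho : Odd (2 * m - 2 - ((k : ℕ) + 1)) := by
        rw [Nat.odd_iff]
        rw [Nat.even_iff] at he
        omega
      rw [he.neg_one_pow, ho.neg_one_pow, neg_neg]
    · have he : Even (2 * m - 2 - ((k : ℕ) + 1)) := by
        rw [Nat.even_iff]
        rw [Nat.odd_iff] at ho
        omega
      rw [he.neg_one_pow, ho.neg_one_pow]
  rw [h]
  ring

theorem altForm_shift (N : ℕ) (v w : Fin N → ℂ) :
    altForm N (shift N v) w = -altForm N v (shift N w) := by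
  cases N with
  | zero => simp [altForm]
  | succ M =>
    simp only [altForm]
    rw [Fin.sum_univ_succ, Fin.sum_univ_castSucc]
    have h0 : shift (M + 1) v 0 = 0 := by simp [shift]
    have h1 : shift (M + 1) w (Fin.last M).rev = 0 := by simp [shift]
    rw [h0, h1, mul_zero, zero_mul, mul_zero, zero_add, add_zero, ← Finset.sum_neg_distrib]
    refine Finset.sum_congr rfl fun k _ => ?_
    have hk := k.2
    have h2 : shift (M + 1) v k.succ = v k.castSucc := by
      simp only [shift, LinearMap.coe_mk, AddHom.coe_mk, Fin.val_succ]
      rw [if_neg (by omega)]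
      rfl
    have h3 : shift (M + 1) w k.castSucc.rev = w k.succ.rev := by
      simp only [shift, LinearMap.coe_mk, AddHom.coe_mk]
      rw [if_neg (by rw [Fin.val_rev, Fin.val_castSucc]; omega)]
      congr 1
    rw [h2, h3, Fin.val_succ, Fin.val_castSucc, pow_succ]
    ring

theorem altForm_shift_pow (N j : ℕ) (v w : Fin N → ℂ) :
    altForm N ((shift N ^ j) v) w = (-1) ^ j * altForm N v ((shift N ^ j) w) := by
  induction j generalizing v with
  | zero => simp
  | succ j ih =>
    rw [pow_succ, Module.End.mul_apply, ih, altForm_shift, ← Module.End.mul_apply, ← pow_succ',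
      pow_succ, pow_succ]
    ring

/-- The operator `e_i ↦ [e_i, x] = e_i + ∑_{k ≥ 2, 2k-1+i ≤ 2m-1} α_{2k} e_{2k-1+i}` on
`⟨e_2, …, e_{2m-1}⟩`. -/
def tauOp (m : ℕ) (α : ℕ → ℂ) : Module.End ℂ (Fin (2 * m - 2) → ℂ) :=
  1 + ∑ k ∈ Finset.Icc 2 (m - 1), α (2 * k) • shift (2 * m - 2) ^ (2 * k - 1)

theorem shift_tauOp (m : ℕ) (α : ℕ → ℂ) (v : Fin (2 * m - 2) → ℂ) :
    shift (2 * m - 2) (tauOp m α v) = tauOp m α (shift (2 * m - 2) v) := by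
  have h : Commute (shift (2 * m - 2)) (tauOp m α) :=
    (Commute.one_right _).add_right
      (Commute.sum_right _ _ _ fun j _ => ((Commute.refl _).pow_right _).smul_right _)
  exact congrArg (fun f : Module.End ℂ (Fin (2 * m - 2) → ℂ) => f v) h.eq

theorem altForm_sum_left (N : ℕ) (s : Finset ℕ) (f : ℕ → Fin N → ℂ) (w : Fin N → ℂ) :
    altForm N (∑ k ∈ s, f k) w = ∑ k ∈ s, altForm N (f k) w := by
  induction s using Finset.induction_on with
  | empty => simp [altForm]
  | insert a s ha ih => rw [Finset.sum_insert ha, Finset.sum_insert ha, altForm_add_left, ih]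

theorem altForm_sum_right (N : ℕ) (s : Finset ℕ) (f : ℕ → Fin N → ℂ) (w : Fin N → ℂ) :
    altForm N w (∑ k ∈ s, f k) = ∑ k ∈ s, altForm N w (f k) := by
  induction s using Finset.induction_on with
  | empty => simp [altForm]
  | insert a s ha ih => rw [Finset.sum_insert ha, Finset.sum_insert ha, altForm_add_right, ih]

theorem altForm_tauOp (m : ℕ) (α : ℕ → ℂ) (v w : Fin (2 * m - 2) → ℂ) :
    altForm (2 * m - 2) (tauOp m α v) w =
      2 * altForm (2 * m - 2) v w - altForm (2 * m - 2) v (tauOp m α w) := by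
  simp only [tauOp, LinearMap.add_apply, Module.End.one_apply, LinearMap.sum_apply,
    LinearMap.smul_apply, altForm_add_left, altForm_add_right, altForm_sum_left,
    altForm_sum_right, altForm_smul_left, altForm_smul_right]
  have h : ∀ k ∈ Finset.Icc 2 (m - 1),
      α (2 * k) * altForm (2 * m - 2) ((shift (2 * m - 2) ^ (2 * k - 1)) v) w =
        -(α (2 * k) * altForm (2 * m - 2) v ((shift (2 * m - 2) ^ (2 * k - 1)) w)) := by
    intro k hk
    rw [Finset.mem_Icc] at hk
    have ho : Odd (2 * k - 1) := by
      rw [Nat.odd_iff]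
      omega
    rw [altForm_shift_pow, ho.neg_one_pow]
    ring
  rw [Finset.sum_congr rfl h, Finset.sum_neg_distrib]
  ring

/-- The Lie algebra `τ³_{2m,1}(α₄, α₆, …, α_{2m-2})` with basis `x, e_1, e_2, …, e_{2m}`. The
element `⟨a, b, v, z⟩` is `a x + b e_1 + v + z e_{2m}` with `v ∈ ⟨e_2, …, e_{2m-1}⟩`.
Only the values `α 4, α 6, …, α (2m-2)` of `α` matter. -/
@[ext]
structure Tau3 (m : ℕ) (α : ℕ → ℂ) where
  cx : ℂ
  c1 : ℂ
  v : Fin (2 * m - 2) → ℂ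
  cz : ℂ

namespace Tau3

variable {m : ℕ} {α : ℕ → ℂ}

/-- Coordinates. -/
def equivProd (m : ℕ) (α : ℕ → ℂ) : Tau3 m α ≃ ℂ × ℂ × (Fin (2 * m - 2) → ℂ) × ℂ where
  toFun u := (u.cx, u.c1, u.v, u.cz)
  invFun p := ⟨p.1, p.2.1, p.2.2.1, p.2.2.2⟩

instance : AddCommGroup (Tau3 m α) := (equivProd m α).addCommGroup

instance : Module ℂ (Tau3 m α) := (equivProd m α).module ℂ

@[simp] theorem add_cx (u w : Tau3 m α) : (u + w).cx = u.cx + w.cx := rfl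
@[simp] theorem add_c1 (u w : Tau3 m α) : (u + w).c1 = u.c1 + w.c1 := rfl
@[simp] theorem add_v (u w : Tau3 m α) : (u + w).v = u.v + w.v := rfl
@[simp] theorem add_cz (u w : Tau3 m α) : (u + w).cz = u.cz + w.cz := rfl
@[simp] theorem smul_cx (t : ℂ) (u : Tau3 m α) : (t • u).cx = t * u.cx := rfl
@[simp] theorem smul_c1 (t : ℂ) (u : Tau3 m α) : (t • u).c1 = t * u.c1 := rfl
@[simp] theorem smul_v (t : ℂ) (u : Tau3 m α) : (t • u).v = t • u.v := rfl
@[simp] theorem smul_cz (t : ℂ) (u : Tau3 m α) : (t • u).cz = t * u.cz := rfl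
@[simp] theorem zero_cx : (0 : Tau3 m α).cx = 0 := rfl
@[simp] theorem zero_c1 : (0 : Tau3 m α).c1 = 0 := rfl
@[simp] theorem zero_v : (0 : Tau3 m α).v = 0 := rfl
@[simp] theorem zero_cz : (0 : Tau3 m α).cz = 0 := rfl

instance : Bracket (Tau3 m α) (Tau3 m α) where
  bracket u w :=
    { cx := 0
      c1 := 0
      v := w.cx • tauOp m α u.v + w.c1 • shift (2 * m - 2) u.v
        - (u.cx • tauOp m α w.v + u.c1 • shift (2 * m - 2) w.v)
      cz := altForm (2 * m - 2) u.v w.v + (2 * u.cz * w.cx - 2 * w.cz * u.cx) }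

@[simp] theorem lie_cx (u w : Tau3 m α) : ⁅u, w⁆.cx = 0 := rfl
@[simp] theorem lie_c1 (u w : Tau3 m α) : ⁅u, w⁆.c1 = 0 := rfl
@[simp] theorem lie_v (u w : Tau3 m α) : ⁅u, w⁆.v =
    w.cx • tauOp m α u.v + w.c1 • shift (2 * m - 2) u.v
      - (u.cx • tauOp m α w.v + u.c1 • shift (2 * m - 2) w.v) := rfl
@[simp] theorem lie_cz (u w : Tau3 m α) : ⁅u, w⁆.cz =
    altForm (2 * m - 2) u.v w.v + (2 * u.cz * w.cx - 2 * w.cz * u.cx) := rfl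

instance : LieRing (Tau3 m α) where
  add_lie u v w := by
    refine Tau3.ext (by simp) (by simp) ?_ ?_
    · simp only [lie_v, add_cx, add_c1, add_v, map_add]
      module
    · simp only [lie_cz, add_cx, add_v, add_cz, altForm_add_left]
      ring
  lie_add u v w := by
    refine Tau3.ext (by simp) (by simp) ?_ ?_
    · simp only [lie_v, add_cx, add_c1, add_v, map_add]
      module
    · simp only [lie_cz, add_cx, add_v, add_cz, altForm_add_right]
      ring
  lie_self u := by
    refine Tau3.ext (by simp) (by simp) (by simp) ?_
    have h := altForm_swap m u.v u.v
    simp only [lie_cz, zero_cz]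
    linear_combination (1 / 2 : ℂ) * h
  leibniz_lie u v w := by
    refine Tau3.ext (by simp) (by simp) ?_ ?_
    · simp only [lie_v, lie_cx, lie_c1, add_v, map_add, map_sub, map_smul, shift_tauOp]
      module
    · have hsub_left : ∀ a b c : Fin (2 * m - 2) → ℂ, altForm (2 * m - 2) (a - b) c =
          altForm (2 * m - 2) a c - altForm (2 * m - 2) b c := fun a b c => by
        rw [sub_eq_add_neg, ← neg_one_smul ℂ b, altForm_add_left, altForm_smul_left]
        ring
      have hsub_right : ∀ a b c : Fin (2 * m - 2) → ℂ, altForm (2 * m - 2) a (b - c) =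
          altForm (2 * m - 2) a b - altForm (2 * m - 2) a c := fun a b c => by
        rw [sub_eq_add_neg, ← neg_one_smul ℂ c, altForm_add_right, altForm_smul_right]
        ring
      simp only [lie_cz, lie_v, lie_cx, add_cz, hsub_left, hsub_right, altForm_add_left,
        altForm_add_right, altForm_smul_left, altForm_smul_right, altForm_shift, altForm_tauOp]
      have s2 := altForm_swap m v.v (tauOp m α u.v)
      have s3 := altForm_swap m v.v (shift (2 * m - 2) u.v)
      rw [altForm_tauOp] at s2
      rw [altForm_shift] at s3
      linear_combination -w.cx * s2 - w.c1 * s3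

instance : LieAlgebra ℂ (Tau3 m α) where
  lie_smul t u w := by
    refine Tau3.ext (by simp) (by simp) ?_ ?_
    · simp only [lie_v, smul_cx, smul_c1, smul_v, map_smul]
      module
    · simp only [lie_cz, smul_cx, smul_v, smul_cz, altForm_smul_right]
      ring

/-- The basis vector `x`. -/
def x : Tau3 m α := ⟨1, 0, 0, 0⟩

/-- The basis vectors `e_1, …, e_{2m}` (zero for other indices, when `1 < m`). -/
def e (i : ℕ) : Tau3 m α :=
  ⟨0, if i = 1 then 1 else 0, unitVec (2 * m - 2) i, if i = 2 * m then 1 else 0⟩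

/-! The multiplication table. -/

theorem lie_e_e_one {i : ℕ} (hi : 2 ≤ i) (him : i ≤ 2 * m - 2) :
    ⁅(e i : Tau3 m α), (e 1 : Tau3 m α)⁆ = e (i + 1) := by
  have h1 : i ≠ 1 := by omega
  have h0 : i ≠ 0 := by omega
  have h2 : i + 1 ≠ 2 * m := by omega
  ext1 <;> simp [e, shift_unitVec _ _ hi, h1, h0, h2, unitVec_one, altForm]

theorem lie_e_e {i j : ℕ} (hi : 2 ≤ i) (hj : 2 ≤ j) (him : i ≤ 2 * m - 1) (hjm : j ≤ 2 * m - 1) :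
    ⁅(e i : Tau3 m α), (e j : Tau3 m α)⁆ =
      if i + j = 2 * m + 1 then (-1 : ℂ) ^ i • e (2 * m) else 0 := by
  have h1 : i ≠ 1 := by omega
  have h2 : j ≠ 1 := by omega
  have h3 : m ≠ 0 := by omega
  have h4 : i ≠ 2 * m := by omega
  have h5 : j ≠ 2 * m := by omega
  have hu : unitVec (2 * m - 2) (2 * m) = 0 := unitVec_eq_zero _ _ (by omega)
  have hω : altForm (2 * m - 2) (unitVec (2 * m - 2) i) (unitVec (2 * m - 2) j) =
      if i + j = 2 * m + 1 then (-1) ^ i else 0 := by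
    have hlt : i - 2 < 2 * m - 2 := by omega
    rw [altForm, Finset.sum_eq_single (⟨i - 2, hlt⟩ : Fin (2 * m - 2))]
    · have hp : (-1 : ℂ) ^ i = (-1) ^ (i - 2) := by
        conv_lhs => rw [show i = i - 2 + 2 by omega, pow_add]
        simp
      simp only [unitVec, Fin.val_rev]
      rw [if_pos (by omega), hp, mul_one]
      split_ifs <;> first | omega | simp
    · intro k _ hk
      have : (k : ℕ) + 2 ≠ i := fun h => hk (Fin.ext (by simp; omega))
      simp [unitVec, this]
    · intro h
      exact absurd (Finset.mem_univ _) h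
  split_ifs with h
  · rw [if_pos h] at hω
    ext1 <;> simp [e, h1, h2, h4, h5, hu, hω]
  · rw [if_neg h] at hω
    ext1 <;> simp [e, h1, h2, h4, h5, hω]

theorem lie_e_last (hm : 1 ≤ m) {i : ℕ} :
    ⁅(e (2 * m) : Tau3 m α), (e i : Tau3 m α)⁆ = 0 := by
  have hu : unitVec (2 * m - 2) (2 * m) = 0 := unitVec_eq_zero _ _ (by omega)
  have h1 : 2 * m ≠ 1 := by omega
  ext1 <;> simp [e, hu, h1, altForm]

theorem lie_e_one_x : ⁅(e 1 : Tau3 m α), (x : Tau3 m α)⁆ = 0 := by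
  have h : 1 ≠ 2 * m := by omega
  ext1 <;> simp [e, x, unitVec_one, altForm, h]

theorem lie_e_x {i : ℕ} (hi : 2 ≤ i) (him : i ≤ 2 * m - 1) :
    ⁅(e i : Tau3 m α), (x : Tau3 m α)⁆ =
      e i + ∑ k ∈ Finset.Icc 2 ((2 * m - i) / 2), α (2 * k) • e (2 * k - 1 + i) := by
  have h1 : ∑ k ∈ Finset.Icc 2 ((2 * m - i) / 2), α (2 * k) • (e (2 * k - 1 + i) : Tau3 m α) =
      ⟨0, 0, ∑ k ∈ Finset.Icc 2 ((2 * m - i) / 2),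
        α (2 * k) • unitVec (2 * m - 2) (2 * k - 1 + i), 0⟩ := by
    have key : ∀ s : Finset ℕ, (∀ k ∈ s, 2 ≤ k ∧ 2 * k - 1 + i < 2 * m) →
        ∑ k ∈ s, α (2 * k) • (e (2 * k - 1 + i) : Tau3 m α) =
          ⟨0, 0, ∑ k ∈ s, α (2 * k) • unitVec (2 * m - 2) (2 * k - 1 + i), 0⟩ := by
      intro s
      induction s using Finset.induction_on with
      | empty => intro _; rfl
      | insert a s ha ih =>
        intro h
        have ha1 := h a (Finset.mem_insert_self a s)
        have ha2 : 2 * a - 1 + i ≠ 1 := by omega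
        have ha3 : 2 * a - 1 + i ≠ 2 * m := by omega
        rw [Finset.sum_insert ha, Finset.sum_insert ha,
          ih fun l hl => h l (Finset.mem_insert_of_mem hl)]
        ext1 <;> simp [e, ha2, ha3]
    refine key _ fun l hl => ?_
    rw [Finset.mem_Icc] at hl
    omega
  have h2 : ∑ k ∈ Finset.Icc 2 ((2 * m - i) / 2),
        α (2 * k) • unitVec (2 * m - 2) (2 * k - 1 + i) =
      ∑ k ∈ Finset.Icc 2 (m - 1), α (2 * k) • unitVec (2 * m - 2) (i + (2 * k - 1)) := by
    simp only [add_comm i]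
    refine Finset.sum_subset (fun k hk => ?_) fun k hk hk' => ?_
    · rw [Finset.mem_Icc] at hk ⊢
      omega
    · rw [Finset.mem_Icc] at hk hk'
      rw [unitVec_eq_zero _ _ (by omega), smul_zero]
  have h3 : i ≠ 1 := by omega
  have h4 : i ≠ 2 * m := by omega
  rw [h1, h2]
  ext1 <;> simp [e, x, h3, h4, tauOp, LinearMap.sum_apply, shift_pow_unitVec _ _ _ hi, altForm]

theorem lie_e_last_x (hm : 1 ≤ m) :
    ⁅(e (2 * m) : Tau3 m α), (x : Tau3 m α)⁆ = (2 : ℂ) • e (2 * m) := by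
  have hu : unitVec (2 * m - 2) (2 * m) = 0 := unitVec_eq_zero _ _ (by omega)
  have h1 : 2 * m ≠ 1 := by omega
  ext1 <;> simp [e, x, hu, h1, altForm]

end Tau3

end Tau3

end FiliformExt

end

noncomputable section

/-! ### The shift operator and its commutant. -/

namespace FiliformExt

/-! Put V = ⟨e_2, …, e_n⟩. The structure of L is carried by two operators on V: the shift S (bracket
with e_1), a single nilpotent Jordan block, and D (bracket with x), a polynomial in S with constant
term 1. A cocycle is then a quadruple: an alternating form ω on V, functionals f = ψ(·, e_1) and g =
ψ(·, x), and c = ψ(e_1, x). The cocycle identity says that S is skew for ω, that ω(Dv, w) + ω(v, Dw)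
= -γ ω(v, w), and that f∘D = g∘S - γ f (`exists_form`, `exists_twoCocycle`).

The centre of N is the line through e_n, so non-split means f(e_n) ≠ 0 or ω(e_n, ·) ≠ 0. Since D e_n
= e_n and S e_n = 0, the first forces γ = -1. Moving D across ω replaces S by -S, so ω(v, Pw) = 0
with P equal to 2 + γ plus twice the sum of the terms α_j S^(j-1) with j odd. P is invertible unless
γ = -2, and then ω = 0. If γ = -2 and ω(e_n, ·) ≠ 0, the same identity kills the odd-index
parameters one by one, and the clash between alternation and skewness of S forces n odd.

For γ = -1 the extended shift (v, t) ↦ (Sv, f v) on V ⊕ ℂ is again one Jordan block because f(e_n) ≠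
0. The extended D commutes with it, so it is determined by its value on e_2, which adds just one
parameter (`nonempty_equiv_s4_update`).

For γ = -2 the operator D - 2 is invertible, so a coboundary removes f and g (`exists_primitive`).
The remaining form is ω(v, w) = altForm(v, q(S²)w) for a polynomial q with q(0) ≠ 0. A truncated
square root r of q gives R = r(S²), self-adjoint for the standard form and commuting with S and D,
which carries ω to that form (`exists_isUnit_altForm_eq`). The converses use explicit f, g or ω in
the same dictionary. -/

theorem shift_apply_zero (N : ℕ) (v : Fin (N + 1) → ℂ) : shift (N + 1) v 0 = 0 := rfl

theorem shift_apply_succ (N : ℕ) (v : Fin (N + 1) → ℂ) (i : Fin N) :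
    shift (N + 1) v i.succ = v i.castSucc := rfl

theorem pi_single_eq_unitVec (N : ℕ) (i : Fin N) :
    (Pi.single i 1 : Fin N → ℂ) = unitVec N (i + 2) := by
  funext k
  simp [unitVec, Pi.single_apply, Fin.ext_iff]

theorem unitVec_eq_shift_pow (N : ℕ) (i : Fin N) :
    unitVec N (i + 2) = (shift N ^ (i : ℕ)) (unitVec N 2) := by
  rw [shift_pow_unitVec _ _ _ le_rfl, add_comm]

/-- The vector e_2 is cyclic for the shift, so its orbit is the whole basis. -/
theorem linearMap_ext_unitVec {N : ℕ} {W : Type*} [AddCommGroup W] [Module ℂ W]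
    {E F : (Fin N → ℂ) →ₗ[ℂ] W}
    (h : ∀ i < N, E ((shift N ^ i) (unitVec N 2)) = F ((shift N ^ i) (unitVec N 2))) :
    E = F := by
  refine LinearMap.pi_ext' fun i => LinearMap.ext_ring ?_
  simp only [LinearMap.comp_apply, LinearMap.coe_single]
  rw [pi_single_eq_unitVec, unitVec_eq_shift_pow]
  exact h i i.2

theorem shift_pow_self (N : ℕ) : shift N ^ N = 0 := by
  refine linearMap_ext_unitVec fun i _ => ?_
  rw [← Module.End.mul_apply, ← pow_add, shift_pow_unitVec _ _ _ le_rfl,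
    unitVec_eq_zero _ _ (by omega), LinearMap.zero_apply]

theorem isNilpotent_shift (N : ℕ) : IsNilpotent (shift N) := ⟨N, shift_pow_self N⟩

/-- An operator commuting with the shift is determined by its value on `e_2`. -/
theorem eq_of_commute_shift {N : ℕ} {E F : Module.End ℂ (Fin N → ℂ)}
    (hE : ∀ v, E (shift N v) = shift N (E v)) (hF : ∀ v, F (shift N v) = shift N (F v))
    (h : E (unitVec N 2) = F (unitVec N 2)) : E = F := by
  have key : ∀ G : Module.End ℂ (Fin N → ℂ), (∀ v, G (shift N v) = shift N (G v)) →
      ∀ i v, G ((shift N ^ i) v) = (shift N ^ i) (G v) := by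
    intro G hG i
    induction i with
    | zero => simp
    | succ i ih =>
      intro v
      rw [pow_succ', Module.End.mul_apply, Module.End.mul_apply, hG, ih]
  refine linearMap_ext_unitVec fun i _ => ?_
  rw [key E hE, key F hF, h]

/-- An operator `c + T` with `c ≠ 0` and `T` in the ideal generated by the shift is invertible. -/
theorem isUnit_smul_one_add_sum {N : ℕ} {c : ℂ} (hc : c ≠ 0) (s : Finset ℕ) (β : ℕ → ℂ)
    (m : ℕ → ℕ) (hm : ∀ j ∈ s, m j ≠ 0) :
    IsUnit (c • (1 : Module.End ℂ (Fin N → ℂ)) + ∑ j ∈ s, β j • shift N ^ m j) := by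
  have hcomm : ∀ i j : ℕ, Commute (β i • shift N ^ m i) (β j • shift N ^ m j) := fun i j =>
    (((Commute.refl (shift N)).pow_pow _ _).smul_left _).smul_right _
  have hnil : IsNilpotent (∑ j ∈ s, β j • shift N ^ m j) :=
    Commute.isNilpotent_sum
      (fun j hj => ((isNilpotent_shift N).pow_of_pos (hm j hj)).smul _) fun i j _ _ => hcomm i j
  have hu : IsUnit (c • (1 : Module.End ℂ (Fin N → ℂ))) := by
    rw [← Algebra.algebraMap_eq_smul_one]
    exact (IsUnit.mk0 c hc).map _
  exact hnil.isUnit_add_left_of_commute hu ((Commute.one_right _).smul_right _)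

/-- D commutes with the shift, so this one column determines it. Its entries are the parameters
themselves, with α_{i+1} at e_{i+2}. -/
theorem s4Op_unitVec_two (n : ℕ) (α : ℕ → ℂ) (i : Fin (n - 1)) :
    s4Op n α (unitVec (n - 1) 2) i =
      if (i : ℕ) = 0 then 1 else if (i : ℕ) = 1 then 0 else α (i + 1) := by
  have hi := i.2
  simp only [s4Op, LinearMap.add_apply, LinearMap.sum_apply, LinearMap.smul_apply,
    Module.End.one_apply, shift_pow_unitVec _ _ _ le_rfl, Pi.add_apply, Finset.sum_apply,
    Pi.smul_apply, smul_eq_mul]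
  by_cases h : 2 ≤ (i : ℕ)
  · rw [Finset.sum_eq_single ((i : ℕ) + 1)]
    · simp only [unitVec]
      split_ifs <;> first | omega | simp
    · intro j hj hne
      rw [Finset.mem_Icc] at hj
      simp only [unitVec]
      rw [if_neg (by omega), mul_zero]
    · intro hj
      rw [Finset.mem_Icc] at hj
      omega
  · rw [Finset.sum_eq_zero]
    · simp only [unitVec]
      split_ifs <;> first | omega | simp
    · intro j hj
      rw [Finset.mem_Icc] at hj
      simp only [unitVec]
      rw [if_neg (by omega), mul_zero]

theorem s4Op_of_shift_eq_zero (n : ℕ) (α : ℕ → ℂ) {v : Fin (n - 1) → ℂ}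
    (hv : shift (n - 1) v = 0) : s4Op n α v = v := by
  simp only [s4Op, LinearMap.add_apply, LinearMap.sum_apply, LinearMap.smul_apply,
    Module.End.one_apply]
  rw [Finset.sum_eq_zero, add_zero]
  intro j hj
  rw [Finset.mem_Icc] at hj
  rw [show j - 1 = (j - 2) + 1 by omega, pow_succ, Module.End.mul_apply, hv, map_zero, smul_zero]

/-! ### The nilradical of `S4`. -/

namespace S4

variable {n : ℕ} {α : ℕ → ℂ}

@[simp] theorem neg_cx (u : S4 n α) : (-u).cx = -u.cx := rfl
@[simp] theorem neg_c1 (u : S4 n α) : (-u).c1 = -u.c1 := rfl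
@[simp] theorem neg_v (u : S4 n α) : (-u).v = -u.v := rfl

/-- The inclusion of `⟨e_2, …, e_n⟩`. -/
def ofV (n : ℕ) (α : ℕ → ℂ) : (Fin (n - 1) → ℂ) →ₗ[ℂ] S4 n α where
  toFun v := ⟨0, 0, v⟩
  map_add' v w := by ext1 <;> simp
  map_smul' t v := by ext1 <;> simp

@[simp] theorem ofV_cx (v : Fin (n - 1) → ℂ) : (ofV n α v).cx = 0 := rfl
@[simp] theorem ofV_c1 (v : Fin (n - 1) → ℂ) : (ofV n α v).c1 = 0 := rfl
@[simp] theorem ofV_v (v : Fin (n - 1) → ℂ) : (ofV n α v).v = v := rfl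
@[simp] theorem x_cx : (x : S4 n α).cx = 1 := rfl
@[simp] theorem x_c1 : (x : S4 n α).c1 = 0 := rfl
@[simp] theorem x_v : (x : S4 n α).v = 0 := rfl
@[simp] theorem e_one_cx : (e 1 : S4 n α).cx = 0 := rfl
@[simp] theorem e_one_c1 : (e 1 : S4 n α).c1 = 1 := rfl
@[simp] theorem e_one_v : (e 1 : S4 n α).v = 0 := unitVec_one _

theorem eq_sum (u : S4 n α) : u = u.cx • x + u.c1 • e 1 + ofV n α u.v := by
  ext1 <;> simp

/-- The ideal `⟨e_1, …, e_n⟩`. -/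
def nilIdeal (n : ℕ) (α : ℕ → ℂ) : LieIdeal ℂ (S4 n α) where
  carrier := {u | u.cx = 0}
  add_mem' {u w} hu hw := by
    simp only [Set.mem_ofPred_eq] at *
    simp [hu, hw]
  zero_mem' := rfl
  smul_mem' t u hu := by
    simp only [Set.mem_ofPred_eq] at *
    simp [hu]
  lie_mem {u w} _ := (rfl : ⁅u, w⁆.cx = 0)

theorem mem_nilIdeal {u : S4 n α} : u ∈ nilIdeal n α ↔ u.cx = 0 := by
  rw [nilIdeal, LieSubmodule.mem_mk_iff', Submodule.mem_mk]
  exact Set.mem_ofPred_eq ▸ Iff.rfl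

instance : Module.Finite ℂ (S4 n α) :=
  Module.Finite.equiv
    ({ equivProd n α with
        map_add' := fun _ _ => rfl
        map_smul' := fun _ _ => rfl } : S4 n α ≃ₗ[ℂ] ℂ × ℂ × (Fin (n - 1) → ℂ)).symm

theorem lie_ofV {u : S4 n α} (hu : u.cx = 0) (v : Fin (n - 1) → ℂ) :
    ⁅u, ofV n α v⁆ = ofV n α ((-u.c1) • shift (n - 1) v) := by
  refine S4.ext rfl rfl ?_
  rw [lie_v, ofV_cx, ofV_c1, ofV_v, ofV_v, hu]
  module

theorem coe_lie_nilIdeal (u w : nilIdeal n α) :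
    ((⁅u, w⁆ : nilIdeal n α) : S4 n α) = ⁅(u : S4 n α), (w : S4 n α)⁆ := rfl

/-- By Engel it suffices that each ad u is nilpotent. One bracket lands in V, where ad u acts as a
multiple of the shift. -/
theorem isNilpotent_nilIdeal : LieRing.IsNilpotent (nilIdeal n α) := by
  rw [LieAlgebra.isNilpotent_iff_forall (R := ℂ)]
  intro u
  have h0 : (u : S4 n α).cx = 0 := mem_nilIdeal.1 u.2
  have key : ∀ (i : ℕ) (w : nilIdeal n α),
      (((LieAlgebra.ad ℂ (nilIdeal n α) u) ^ (i + 1)) w : S4 n α) =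
        ofV n α ((-(u : S4 n α).c1) ^ i •
          (shift (n - 1) ^ i) (⁅(u : S4 n α), (w : S4 n α)⁆.v)) := by
    intro i w
    induction i with
    | zero =>
      rw [zero_add, pow_one, pow_zero, pow_zero, one_smul]
      exact S4.ext rfl rfl rfl
    | succ i ih =>
      rw [pow_succ', Module.End.mul_apply, LieAlgebra.ad_apply, coe_lie_nilIdeal, ih, lie_ofV h0]
      refine congrArg (ofV n α) ?_
      rw [map_smul, smul_smul, ← pow_succ', pow_succ' (shift _), Module.End.mul_apply]
  refine ⟨n - 1 + 1, LinearMap.ext fun w => Subtype.ext ?_⟩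
  rw [key, shift_pow_self]
  simp

/-- If an ideal contains u with nonzero x-component, it also contains e_n. There ad u acts by the
nonzero scalar -u.cx, so the ideal is not nilpotent. -/
theorem mem_nilradical (hn : 2 ≤ n) {u : S4 n α} : u ∈ nilradical (S4 n α) ↔ u.cx = 0 := by
  rw [← mem_nilIdeal]
  suffices h : nilradical (S4 n α) = nilIdeal n α by rw [h]
  refine le_antisymm (sSup_le fun I hI u hu => ?_) (le_sSup isNilpotent_nilIdeal)
  by_contra hne
  rw [mem_nilIdeal] at hne
  set w : Fin (n - 1) → ℂ := unitVec (n - 1) n with hw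
  have hS : shift (n - 1) w = 0 := by
    rw [hw, shift_unitVec _ _ hn, unitVec_eq_zero _ _ (by omega)]
  have hlie : ⁅u, ofV n α w⁆ = (-u.cx) • ofV n α w := by
    ext1
    · simp
    · simp
    · simp [hS, s4Op_of_shift_eq_zero _ _ hS]
  have hmem : ofV n α w ∈ I := by
    have h1 : ⁅u, ofV n α w⁆ ∈ I := by
      rw [← lie_skew]
      exact neg_mem (I.lie_mem hu)
    rw [hlie] at h1
    have h2 := I.smul_mem (-u.cx)⁻¹ h1
    rwa [smul_smul, inv_mul_cancel₀ (neg_ne_zero.2 hne), one_smul] at h2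
  have hI' : LieRing.IsNilpotent I := hI
  rw [LieAlgebra.isNilpotent_iff_forall (R := ℂ)] at hI'
  obtain ⟨i, hi⟩ := hI' ⟨u, hu⟩
  have hpow : ∀ i : ℕ, ((LieAlgebra.ad ℂ I ⟨u, hu⟩) ^ i) ⟨_, hmem⟩ =
      ((-u.cx) ^ i) • (⟨_, hmem⟩ : I) := by
    intro i
    induction i with
    | zero => simp
    | succ i ih =>
      rw [pow_succ', Module.End.mul_apply, ih, map_smul, pow_succ, mul_smul]
      congr 1
      exact Subtype.ext hlie
  have h3 := hpow i
  rw [hi, LinearMap.zero_apply] at h3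
  have h4 := (smul_eq_zero.1 h3.symm).resolve_left (pow_ne_zero _ (neg_ne_zero.2 hne))
  have h5 : w = 0 := congrArg (fun z : I => (z : S4 n α).v) h4
  have h6 := congrFun h5 ⟨n - 2, by omega⟩
  rw [hw] at h6
  simp only [unitVec, Pi.zero_apply] at h6
  rw [if_pos (by omega)] at h6
  exact one_ne_zero h6

end S4

end FiliformExt

/-! ### Cocycles as linear-algebra data. -/

namespace FiliformExt

open LieModule.Cohomology

/-- The identification of the underlying space of `RepModule θ` with `ℂ`. -/
def RepModule.toComplex {L : Type*} [LieRing L] [LieAlgebra ℂ L] (θ : L →ₗ⁅ℂ⁆ Module.End ℂ ℂ) :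
    RepModule θ ≃ₗ[ℂ] ℂ := LinearEquiv.refl ℂ ℂ

theorem RepModule.toComplex_lie {L : Type*} [LieRing L] [LieAlgebra ℂ L]
    (θ : L →ₗ⁅ℂ⁆ Module.End ℂ ℂ) (u : L) (t : RepModule θ) :
    toComplex θ ⁅u, t⁆ = θ u (toComplex θ t) := rfl

/-- A linear equivalence respecting the brackets identifies the extension by a cocycle with a
given Lie algebra. -/
theorem nonempty_ofTwoCocycle_equiv {L E : Type*} [LieRing L] [LieAlgebra ℂ L] [LieRing E]
    [LieAlgebra ℂ E] {θ : L →ₗ⁅ℂ⁆ Module.End ℂ ℂ} (ψ : twoCocycle ℂ L (RepModule θ))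
    (F : (L × ℂ) ≃ₗ[ℂ] E)
    (hF : ∀ (u w : L) (s t : ℂ), F (⁅u, w⁆, RepModule.toComplex θ (ψ.1 u w) + θ u t - θ w s) =
      ⁅F (u, s), F (w, t)⁆) :
    Nonempty (LieAlgebra.ofTwoCocycle ψ ≃ₗ⁅ℂ⁆ E) := by
  let G : LieAlgebra.ofTwoCocycle ψ ≃ₗ[ℂ] L × RepModule θ :=
    { (LieAlgebra.ofProd ψ).symm with
      map_add' := fun _ _ => rfl
      map_smul' := fun _ _ => rfl }
  let H : LieAlgebra.ofTwoCocycle ψ ≃ₗ[ℂ] E :=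
    (G.trans ((LinearEquiv.refl ℂ L).prodCongr (RepModule.toComplex θ))).trans F
  exact ⟨{ H with map_lie' := fun {a b} => hF _ _ _ _ }⟩

namespace S4

variable {n : ℕ} {α : ℕ → ℂ}

/-- The form on `𝔰⁴_{n,1}` with `(v, w) ↦ ω v w`, `(v, e_1) ↦ f v`, `(v, x) ↦ g v` and
`(e_1, x) ↦ c` for `v, w ∈ ⟨e_2, …, e_n⟩`. -/
def form (ω : (Fin (n - 1) → ℂ) →ₗ[ℂ] (Fin (n - 1) → ℂ) →ₗ[ℂ] ℂ) (f g : (Fin (n - 1) → ℂ) →ₗ[ℂ] ℂ)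
    (c : ℂ) : S4 n α →ₗ[ℂ] S4 n α →ₗ[ℂ] ℂ :=
  LinearMap.mk₂ ℂ (fun u w => ω u.v w.v + (w.c1 * f u.v - u.c1 * f w.v)
    + (w.cx * g u.v - u.cx * g w.v) + c * (u.c1 * w.cx - u.cx * w.c1))
    (fun u u' w => by simp; ring) (fun t u w => by simp; ring)
    (fun u w w' => by simp; ring) (fun t u w => by simp; ring)

theorem form_apply (ω : (Fin (n - 1) → ℂ) →ₗ[ℂ] (Fin (n - 1) → ℂ) →ₗ[ℂ] ℂ)
    (f g : (Fin (n - 1) → ℂ) →ₗ[ℂ] ℂ) (c : ℂ) (u w : S4 n α) :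
    form ω f g c u w = ω u.v w.v + (w.c1 * f u.v - u.c1 * f w.v)
      + (w.cx * g u.v - u.cx * g w.v) + c * (u.c1 * w.cx - u.cx * w.c1) := rfl

/-- The conditions for `form ω f g c` to be a cocycle when `x` acts by the scalar `γ`. -/
structure IsCocycleData (n : ℕ) (α : ℕ → ℂ) (γ : ℂ)
    (ω : (Fin (n - 1) → ℂ) →ₗ[ℂ] (Fin (n - 1) → ℂ) →ₗ[ℂ] ℂ)
    (f g : (Fin (n - 1) → ℂ) →ₗ[ℂ] ℂ) : Prop where
  alt : ∀ v, ω v v = 0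
  shift_left : ∀ v w, ω (shift (n - 1) v) w = -ω v (shift (n - 1) w)
  op_left : ∀ v w, ω (s4Op n α v) w = -γ * ω v w - ω v (s4Op n α w)
  map_op : ∀ v, f (s4Op n α v) = g (shift (n - 1) v) - γ * f v

/-- The quotient by the nilradical is the line spanned by x, so θ is determined by the scalar `θ x
1`. -/
theorem rep_apply (hn : 2 ≤ n) {θ : S4 n α →ₗ⁅ℂ⁆ Module.End ℂ ℂ}
    (hθ : nilradical (S4 n α) ≤ θ.ker) (u : S4 n α) (t : ℂ) : θ u t = θ x 1 * u.cx * t := by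
  have h1 : u - u.cx • x ∈ nilradical (S4 n α) := by
    rw [mem_nilradical hn, sub_eq_add_neg]
    simp
  have h2 := hθ h1
  rw [LieHom.mem_ker, map_sub, map_smul, sub_eq_zero] at h2
  have h3 : θ x t = t * θ x 1 := by
    rw [← smul_eq_mul, ← map_smul, smul_eq_mul, mul_one]
  rw [h2, LinearMap.smul_apply, h3, smul_eq_mul]
  ring

/-- Every cocycle with values in a representation killing the nilradical is given by a form. -/
theorem exists_form (hn : 2 ≤ n) {θ : S4 n α →ₗ⁅ℂ⁆ Module.End ℂ ℂ}
    (hθ : nilradical (S4 n α) ≤ θ.ker) (ψ : twoCocycle ℂ (S4 n α) (RepModule θ)) :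
    ∃ ω f g c, IsCocycleData n α (θ x 1) ω f g ∧
      ∀ u w, RepModule.toComplex θ (ψ.1 u w) = form ω f g c u w := by
  have hrep := rep_apply hn hθ
  generalize θ x 1 = γ at hrep ⊢
  obtain ⟨B, hB⟩ : ∃ B : S4 n α →ₗ[ℂ] S4 n α →ₗ[ℂ] ℂ,
      ∀ u w, RepModule.toComplex θ (ψ.1 u w) = B u w :=
    ⟨ψ.1.1.compr₂ (RepModule.toComplex θ).toLinearMap, fun _ _ => rfl⟩
  have halt : ∀ u, B u u = 0 := fun u => by
    rw [← hB, twoCochain_alt, map_zero]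
  have hskew : ∀ u w, B u w = -B w u := fun u w => by
    rw [← hB, ← hB, ← twoCochain_skew, map_neg]
  have hcoc : ∀ u v w, γ * u.cx * B v w - γ * v.cx * B u w + γ * w.cx * B u v
      - B ⁅u, v⁆ w + B ⁅u, w⁆ v - B ⁅v, w⁆ u = 0 := by
    intro u v w
    have h := (mem_twoCocycle_iff ℂ (S4 n α) (RepModule θ) ψ.1).1 ψ.2
    have h1 := d₂₃_apply ℂ (S4 n α) (RepModule θ) ψ.1 u v w
    rw [h] at h1
    have h2 := congrArg (RepModule.toComplex θ) h1
    simp only [map_add, map_sub, RepModule.toComplex_lie, hrep, hB,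
      LinearMap.zero_apply, map_zero] at h2
    exact h2.symm
  refine ⟨B.compl₁₂ (ofV n α) (ofV n α), (B.flip (e 1)).comp (ofV n α),
    (B.flip x).comp (ofV n α), B (e 1) x, ⟨fun v => halt _, fun v w => ?_, fun v w => ?_,
    fun v => ?_⟩, fun u w => ?_⟩
  -- The triple (v, w, e_1) yields skewness of S. The triples (v, w, x) and (v, e_1, x) below yield
  -- the conditions on D for ω and for f.
  · have h := hcoc (ofV n α v) (ofV n α w) (e 1)
    have h1 : ⁅ofV n α v, ofV n α w⁆ = 0 := S4.ext rfl rfl (by simp)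
    have h2 : ⁅ofV n α v, e 1⁆ = ofV n α (shift (n - 1) v) := S4.ext rfl rfl (by simp)
    have h3 : ⁅ofV n α w, e 1⁆ = ofV n α (shift (n - 1) w) := S4.ext rfl rfl (by simp)
    rw [h1, h2, h3, hskew _ (ofV n α v)] at h
    simp only [ofV_cx, e_one_cx, map_zero, LinearMap.zero_apply] at h
    simp only [LinearMap.compl₁₂_apply]
    linear_combination h
  · have h := hcoc (ofV n α v) (ofV n α w) x
    have h1 : ⁅ofV n α v, ofV n α w⁆ = 0 := S4.ext rfl rfl (by simp)
    have h2 : ⁅ofV n α v, x⁆ = ofV n α (s4Op n α v) := S4.ext rfl rfl (by simp)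
    have h3 : ⁅ofV n α w, x⁆ = ofV n α (s4Op n α w) := S4.ext rfl rfl (by simp)
    rw [h1, h2, h3, hskew _ (ofV n α v)] at h
    simp only [ofV_cx, x_cx, map_zero, LinearMap.zero_apply] at h
    simp only [LinearMap.compl₁₂_apply]
    linear_combination h
  · have h := hcoc (ofV n α v) (e 1) x
    have h1 : ⁅ofV n α v, e 1⁆ = ofV n α (shift (n - 1) v) := S4.ext rfl rfl (by simp)
    have h2 : ⁅ofV n α v, x⁆ = ofV n α (s4Op n α v) := S4.ext rfl rfl (by simp)
    rw [h1, h2, lie_e_one_x] at h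
    simp only [ofV_cx, e_one_cx, x_cx, map_zero, LinearMap.zero_apply] at h
    simp only [LinearMap.comp_apply, LinearMap.flip_apply]
    linear_combination h
  · rw [hB]
    conv_lhs => rw [eq_sum u, eq_sum w]
    simp only [map_add, map_smul, LinearMap.add_apply, LinearMap.smul_apply, halt, form_apply,
      smul_eq_mul, LinearMap.compl₁₂_apply, LinearMap.comp_apply, LinearMap.flip_apply]
    rw [hskew x (e 1), hskew x (ofV n α _), hskew (e 1) (ofV n α _)]
    ring

/-- Cocycle data give a cocycle. -/
theorem exists_twoCocycle (hn : 2 ≤ n) {γ : ℂ}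
    {ω : (Fin (n - 1) → ℂ) →ₗ[ℂ] (Fin (n - 1) → ℂ) →ₗ[ℂ] ℂ} {f g : (Fin (n - 1) → ℂ) →ₗ[ℂ] ℂ}
    (h : IsCocycleData n α γ ω f g) :
    ∃ θ : S4 n α →ₗ⁅ℂ⁆ Module.End ℂ ℂ, nilradical (S4 n α) ≤ θ.ker ∧ θ x = γ • LinearMap.id ∧
      ∃ ψ : twoCocycle ℂ (S4 n α) (RepModule θ),
        ∀ u w, RepModule.toComplex θ (ψ.1 u w) = form ω f g 0 u w := by
  let θ : S4 n α →ₗ⁅ℂ⁆ Module.End ℂ ℂ :=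
    { toFun := fun u => (γ * u.cx) • LinearMap.id
      map_add' := fun u w => by rw [add_cx, mul_add, add_smul]
      map_smul' := fun t u => by
        rw [smul_cx, RingHom.id_apply, smul_smul]
        congr 1
        ring
      map_lie' := fun {u w} => by
        rw [lie_cx, mul_zero, zero_smul, LieRing.of_associative_ring_bracket]
        refine LinearMap.ext fun t => ?_
        simp
        ring }
  have hθ : ∀ u t, θ u t = γ * u.cx * t := fun _ _ => rfl
  have hskew : ∀ v w, ω v w = -ω w v := fun v w => by
    have := h.alt (v + w)
    simp only [map_add, LinearMap.add_apply, h.alt] at this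
    linear_combination this
  refine ⟨θ, fun u hu => ?_, ?_, ⟨⟨(form ω f g 0).compr₂ (RepModule.toComplex θ).symm.toLinearMap,
    fun u => ?_⟩, ?_⟩, fun u w => rfl⟩
  · rw [mem_nilradical hn] at hu
    rw [LieHom.mem_ker]
    refine LinearMap.ext fun t => ?_
    rw [hθ, hu]
    simp
  · refine LinearMap.ext fun t => ?_
    rw [hθ]
    simp
  · refine (RepModule.toComplex θ).injective ?_
    change form ω f g 0 u u = 0
    rw [form_apply, h.alt]
    ring
  · rw [mem_twoCocycle_iff]
    refine LinearMap.ext fun u => LinearMap.ext fun v => LinearMap.ext fun w => ?_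
    rw [d₂₃_apply]
    refine (RepModule.toComplex θ).injective ?_
    change γ * u.cx * form ω f g 0 v w - γ * v.cx * form ω f g 0 u w
      + γ * w.cx * form ω f g 0 u v - form ω f g 0 ⁅u, v⁆ w + form ω f g 0 ⁅u, w⁆ v
      - form ω f g 0 ⁅v, w⁆ u = 0
    simp only [form_apply, lie_cx, lie_c1, lie_v, map_add, map_sub, map_smul, LinearMap.add_apply,
      LinearMap.sub_apply, LinearMap.smul_apply, smul_eq_mul, h.shift_left, h.op_left, h.map_op]
    -- These reversed-order versions bring every ω-term to one normal form, after which the cocycle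
    -- identity is a ring identity.
    have hS : ∀ a b, ω b (shift (n - 1) a) = ω a (shift (n - 1) b) := fun a b => by
      rw [hskew, h.shift_left, neg_neg]
    have hD : ∀ a b, ω b (s4Op n α a) = γ * ω a b + ω a (s4Op n α b) := fun a b => by
      rw [hskew, h.op_left]
      ring
    rw [hS v.v w.v, hS u.v v.v, hS u.v w.v, hD v.v w.v, hD u.v v.v, hD u.v w.v,
      hskew v.v u.v, hskew w.v v.v, hskew w.v u.v]
    ring

/-- The centre of N is the kernel of the shift inside V. Neither g nor c enters, as both involve x,
which lies outside N. -/
theorem isNonSplit_iff (hn : 3 ≤ n) {θ : S4 n α →ₗ⁅ℂ⁆ Module.End ℂ ℂ}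
    {ψ : twoCocycle ℂ (S4 n α) (RepModule θ)}
    {ω : (Fin (n - 1) → ℂ) →ₗ[ℂ] (Fin (n - 1) → ℂ) →ₗ[ℂ] ℂ} {f g : (Fin (n - 1) → ℂ) →ₗ[ℂ] ℂ}
    {c : ℂ} (hψ : ∀ u w, RepModule.toComplex θ (ψ.1 u w) = form ω f g c u w) :
    IsNonSplit ψ ↔ ∀ v, shift (n - 1) v = 0 → f v = 0 → ω v = 0 → v = 0 := by
  have hψ' : ∀ u w, ψ.1 u w = 0 ↔ form ω f g c u w = 0 := fun u w => by
    rw [← hψ, LinearEquiv.map_eq_zero_iff]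
  simp only [IsNonSplit, mem_nilradical (show 2 ≤ n by omega), hψ', form_apply]
  constructor
  · intro h v hS hf hω
    have h1 := h (ofV n α v) rfl (fun y hy => S4.ext rfl rfl ?_) fun y hy => ?_
    · exact congrArg S4.v h1
    · simp [hy, hS]
    · simp [hy, hf, hω]
  · intro h z hz hc hψz
    -- Bracketing with e_2 gives -z.c1 e_3, and e_3 ≠ 0 because n ≥ 3.
    have hc1 : z.c1 = 0 := by
      have h1 := congrArg S4.v (hc (ofV n α (unitVec (n - 1) 2)) rfl)
      rw [lie_ofV hz, ofV_v, zero_v, shift_unitVec _ _ le_rfl] at h1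
      have h2 := congrFun h1 ⟨1, by omega⟩
      simpa [unitVec] using h2
    have hv : z.v = 0 := by
      refine h z.v ?_ ?_ (LinearMap.ext fun w => ?_)
      · have h1 := congrArg S4.v (hc (e 1) e_one_cx)
        simpa [hz, hc1] using h1
      · have h1 := hψz (e 1) e_one_cx
        simpa [hz, hc1] using h1
      · have h1 := hψz (ofV n α w) rfl
        simpa [hz, hc1] using h1
    exact S4.ext hz hc1 hv

end S4

end FiliformExt

/-! ### Isomorphisms with the model algebras; the case γ = -1. -/

namespace FiliformExt

open LieModule.Cohomology

namespace S4

variable {n : ℕ} {α : ℕ → ℂ}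

/-- An isomorphism of an extension with `γ = -1` and `ω = 0` onto some `𝔰⁴_{m,1}`. -/
theorem nonempty_equiv_s4 {θ : S4 n α →ₗ⁅ℂ⁆ Module.End ℂ ℂ}
    {ψ : twoCocycle ℂ (S4 n α) (RepModule θ)} {f g : (Fin (n - 1) → ℂ) →ₗ[ℂ] ℂ} {c : ℂ}
    (hψ : ∀ u w, RepModule.toComplex θ (ψ.1 u w) = form 0 f g c u w)
    (hθ : ∀ u t, θ u t = -1 * u.cx * t) {m : ℕ} {β : ℕ → ℂ}
    (T : ((Fin (n - 1) → ℂ) × ℂ) ≃ₗ[ℂ] (Fin (m - 1) → ℂ))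
    (hS : ∀ v t, T (shift (n - 1) v, f v) = shift (m - 1) (T (v, t)))
    (hD : ∀ v t, T (s4Op n α v, g v + t) = s4Op m β (T (v, t))) :
    Nonempty (LieAlgebra.ofTwoCocycle ψ ≃ₗ⁅ℂ⁆ S4 m β) := by
  -- The adjoined vector has weight 1 under bracket with x, so displacing e_1 by c times it absorbs
  -- ψ(e_1, x) = c.
  let F : (S4 n α × ℂ) ≃ₗ[ℂ] S4 m β :=
    { toFun := fun p => ⟨p.1.cx, p.1.c1, T (p.1.v, p.2 + c * p.1.c1)⟩
      invFun := fun q => (⟨q.cx, q.c1, (T.symm q.v).1⟩, (T.symm q.v).2 - c * q.c1)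
      map_add' := fun p q => by
        refine S4.ext rfl rfl ?_
        rw [add_v, ← map_add]
        refine congrArg T (Prod.ext rfl ?_)
        simp
        ring
      map_smul' := fun r p => by
        refine S4.ext rfl rfl ?_
        rw [RingHom.id_apply, smul_v, ← map_smul]
        refine congrArg T (Prod.ext rfl ?_)
        simp
        ring
      left_inv := fun p => by simp
      right_inv := fun q => by simp }
  have hF : ∀ u t, F (u, t) = ⟨u.cx, u.c1, T (u.v, t + c * u.c1)⟩ := fun _ _ => rfl
  refine nonempty_ofTwoCocycle_equiv ψ F fun u w s t => ?_
  rw [hF, hF, hF]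
  refine S4.ext rfl rfl ?_
  simp only [lie_v]
  rw [← hS _ (s + c * u.c1), ← hD, ← hS _ (t + c * w.c1), ← hD]
  simp only [← map_smul T, ← map_add T, ← map_sub T]
  refine congrArg T (Prod.ext rfl ?_)
  rw [hψ, hθ, hθ, form_apply]
  simp
  ring

/-- An isomorphism of an extension with `γ = -2` onto some `τ³_{2m,1}`. -/
theorem nonempty_equiv_tau3 {θ : S4 n α →ₗ⁅ℂ⁆ Module.End ℂ ℂ}
    {ψ : twoCocycle ℂ (S4 n α) (RepModule θ)}
    {ω : (Fin (n - 1) → ℂ) →ₗ[ℂ] (Fin (n - 1) → ℂ) →ₗ[ℂ] ℂ} {f g : (Fin (n - 1) → ℂ) →ₗ[ℂ] ℂ}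
    {c : ℂ} (hψ : ∀ u w, RepModule.toComplex θ (ψ.1 u w) = form ω f g c u w)
    (hθ : ∀ u t, θ u t = -2 * u.cx * t) {m : ℕ} {β : ℕ → ℂ}
    (R : (Fin (n - 1) → ℂ) ≃ₗ[ℂ] (Fin (2 * m - 2) → ℂ)) (φ : (Fin (n - 1) → ℂ) →ₗ[ℂ] ℂ)
    (hRS : ∀ v, R (shift (n - 1) v) = shift (2 * m - 2) (R v))
    (hRD : ∀ v, R (s4Op n α v) = tauOp m β (R v))
    (hω : ∀ v w, altForm (2 * m - 2) (R v) (R w) = ω v w)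
    (hφS : ∀ v, φ (shift (n - 1) v) = f v) (hφD : ∀ v, φ (s4Op n α v) = g v + 2 * φ v) :
    Nonempty (LieAlgebra.ofTwoCocycle ψ ≃ₗ⁅ℂ⁆ Tau3 m β) := by
  -- Subtracting φ removes the coboundary part f, g. The adjoined vector has weight 2 here, so c/2
  -- is the displacement of e_1 that absorbs c.
  let F : (S4 n α × ℂ) ≃ₗ[ℂ] Tau3 m β :=
    { toFun := fun p => ⟨p.1.cx, p.1.c1, R p.1.v, p.2 - φ p.1.v + c / 2 * p.1.c1⟩
      invFun := fun q => (⟨q.cx, q.c1, R.symm q.v⟩, q.cz + φ (R.symm q.v) - c / 2 * q.c1)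
      map_add' := fun p q => by
        refine Tau3.ext rfl rfl (map_add R _ _) ?_
        simp
        ring
      map_smul' := fun r p => by
        refine Tau3.ext rfl rfl (map_smul R _ _) ?_
        simp
        ring
      left_inv := fun p => by
        refine Prod.ext (S4.ext rfl rfl (R.symm_apply_apply _)) ?_
        simp
        ring
      right_inv := fun q => by
        refine Tau3.ext rfl rfl (R.apply_symm_apply _) ?_
        simp
        ring }
  have hF : ∀ u t, F (u, t) = ⟨u.cx, u.c1, R u.v, t - φ u.v + c / 2 * u.c1⟩ := fun _ _ => rfl
  refine nonempty_ofTwoCocycle_equiv ψ F fun u w s t => ?_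
  rw [hF, hF, hF]
  refine Tau3.ext rfl rfl ?_ ?_
  · simp only [lie_v, Tau3.lie_v, map_sub, map_add, map_smul, hRS, hRD]
  · simp only [lie_v, lie_c1, Tau3.lie_cz, map_sub, map_add, map_smul, hφS, hφD, hω, hψ, hθ,
      form_apply, smul_eq_mul]
    ring

end S4

/-- Adjoining a last coordinate. -/
def snocEquiv (p : ℕ) : ((Fin p → ℂ) × ℂ) ≃ₗ[ℂ] (Fin (p + 1) → ℂ) where
  toFun q := Fin.snoc (α := fun _ => ℂ) q.1 q.2
  invFun w := (fun i => w i.castSucc, w (Fin.last p))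
  map_add' q r := by
    funext i
    refine Fin.lastCases ?_ (fun j => ?_) i <;> simp
  map_smul' t q := by
    funext i
    refine Fin.lastCases ?_ (fun j => ?_) i <;> simp
  left_inv q := by simp
  right_inv w := by
    funext i
    refine Fin.lastCases ?_ (fun j => ?_) i <;> simp

@[simp] theorem snocEquiv_castSucc (p : ℕ) (v : Fin p → ℂ) (t : ℂ) (i : Fin p) :
    snocEquiv p (v, t) i.castSucc = v i := by
  simp [snocEquiv]

@[simp] theorem snocEquiv_last (p : ℕ) (v : Fin p → ℂ) (t : ℂ) :
    snocEquiv p (v, t) (Fin.last p) = t := by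
  simp [snocEquiv]

theorem shift_snocEquiv (p : ℕ) (v : Fin (p + 1) → ℂ) (t : ℂ) :
    shift (p + 2) (snocEquiv (p + 1) (v, t)) =
      snocEquiv (p + 1) (shift (p + 1) v, v (Fin.last p)) := by
  funext i
  refine Fin.cases ?_ (fun i => ?_) i
  · rw [shift_apply_zero, ← Fin.castSucc_zero, snocEquiv_castSucc, shift_apply_zero]
  · rw [shift_apply_succ, snocEquiv_castSucc]
    refine Fin.lastCases ?_ (fun j => ?_) i
    · rw [Fin.succ_last, snocEquiv_last]
    · rw [Fin.succ_castSucc, snocEquiv_castSucc, shift_apply_succ]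

theorem snocEquiv_unitVec (p i : ℕ) (hi : i ≤ p + 1) :
    snocEquiv p (unitVec p i, 0) = unitVec (p + 1) i := by
  funext k
  refine Fin.lastCases ?_ (fun j => ?_) k
  · rw [snocEquiv_last]
    simp only [unitVec, Fin.val_last]
    rw [if_neg (by omega)]
  · rw [snocEquiv_castSucc]
    rfl

/-- The functional `μ` with `μ (S v) = f v - f(e_n) v_n`. -/
def lower (p : ℕ) (f : (Fin (p + 1) → ℂ) →ₗ[ℂ] ℂ) : (Fin (p + 1) → ℂ) →ₗ[ℂ] ℂ :=
  ∑ i : Fin p, f (Pi.single i.castSucc 1) • LinearMap.proj i.succ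

/-- A functional factors through the shift exactly when it vanishes on e_n. The last coordinate,
scaled by the value on e_n, is the obstruction subtracted here. -/
theorem lower_shift (p : ℕ) (f : (Fin (p + 1) → ℂ) →ₗ[ℂ] ℂ) (v : Fin (p + 1) → ℂ) :
    lower p f (shift (p + 1) v) = f v - f (unitVec (p + 1) (p + 2)) * v (Fin.last p) := by
  have hl : unitVec (p + 1) (p + 2) = Pi.single (Fin.last p) 1 := by
    rw [pi_single_eq_unitVec, Fin.val_last]
  have hf : f v = ∑ i, v i * f (Pi.single i 1) := by
    rw [LinearMap.pi_apply_eq_sum_univ f v]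
    refine Finset.sum_congr rfl fun i _ => ?_
    rw [smul_eq_mul]
    congr 2
    funext j
    simp [Pi.single_apply, eq_comm]
  rw [hf, hl, Fin.sum_univ_castSucc, lower, LinearMap.sum_apply]
  simp only [LinearMap.smul_apply, LinearMap.proj_apply, shift_apply_succ, smul_eq_mul]
  rw [mul_comm (f (Pi.single (Fin.last p) 1)), add_sub_cancel_right]
  exact Finset.sum_congr rfl fun i _ => mul_comm _ _

theorem lower_unitVec_two (p : ℕ) (f : (Fin (p + 1) → ℂ) →ₗ[ℂ] ℂ) :
    lower p f (unitVec (p + 1) 2) = 0 := by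
  rw [lower, LinearMap.sum_apply]
  exact Finset.sum_eq_zero fun i _ => by simp [unitVec]

namespace S4

/-- Extensions with `ω = 0`, `γ = -1` and `f(e_n) ≠ 0`. -/
theorem nonempty_equiv_s4_update {p : ℕ} (hp : 1 ≤ p) {α : ℕ → ℂ}
    {θ : S4 (p + 2) α →ₗ⁅ℂ⁆ Module.End ℂ ℂ}
    {ψ : twoCocycle ℂ (S4 (p + 2) α) (RepModule θ)} {f g : (Fin (p + 1) → ℂ) →ₗ[ℂ] ℂ} {c : ℂ}
    (hψ : ∀ u w, RepModule.toComplex θ (ψ.1 u w) = form (n := p + 2) 0 f g c u w)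
    (hθ : ∀ u t, θ u t = -1 * u.cx * t) (h : IsCocycleData (p + 2) α (-1) 0 f g)
    (hf : f (unitVec (p + 1) (p + 2)) ≠ 0) {a : ℂ}
    (ha : f (unitVec (p + 1) (p + 2)) * a =
      g (unitVec (p + 1) 2) - lower p f (s4Op (p + 2) α (unitVec (p + 1) 2))) :
    Nonempty (LieAlgebra.ofTwoCocycle ψ ≃ₗ⁅ℂ⁆ S4 (p + 3) (Function.update α (p + 2) a)) := by
  generalize hκ : f (unitVec (p + 1) (p + 2)) = κ at hf ha
  -- With μ = `lower p f`, subtracting μ turns f into κ times the last coordinate. Dividing by κ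
  -- then makes the extended shift the standard one.
  let T₀ : ((Fin (p + 1) → ℂ) × ℂ) ≃ₗ[ℂ] ((Fin (p + 1) → ℂ) × ℂ) :=
    { toFun := fun q => (q.1, κ⁻¹ * (q.2 - lower p f q.1))
      invFun := fun q => (q.1, κ * q.2 + lower p f q.1)
      map_add' := fun q r => by
        refine Prod.ext rfl ?_
        simp
        ring
      map_smul' := fun t q => by
        refine Prod.ext rfl ?_
        simp
        ring
      left_inv := fun q => by simp [hf]
      right_inv := fun q => by simp [hf] }
  let T : ((Fin (p + 1) → ℂ) × ℂ) ≃ₗ[ℂ] (Fin (p + 2) → ℂ) := T₀.trans (snocEquiv (p + 1))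
  have hT : ∀ v t, T (v, t) = snocEquiv (p + 1) (v, κ⁻¹ * (t - lower p f v)) := fun _ _ => rfl
  have hTS : ∀ v t, T (shift (p + 1) v, f v) = shift (p + 2) (T (v, t)) := by
    intro v t
    rw [hT, hT, shift_snocEquiv, lower_shift, hκ, sub_sub_cancel, inv_mul_cancel_left₀ hf]
  let D : Module.End ℂ (Fin (p + 1) → ℂ) := s4Op (p + 2) α
  have ha' : κ⁻¹ * (g (unitVec (p + 1) 2) - lower p f (D (unitVec (p + 1) 2))) = a := by
    rw [inv_mul_eq_iff_eq_mul₀ hf]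
    exact ha.symm
  let D' : Module.End ℂ (Fin (p + 2) → ℂ) := s4Op (p + 3) (Function.update α (p + 2) a)
  -- Bracket with x on the extended space V ⊕ ℂ, where γ = -1 gives the adjoined coordinate
  -- coefficient 1.
  let D₀ : ((Fin (p + 1) → ℂ) × ℂ) →ₗ[ℂ] ((Fin (p + 1) → ℂ) × ℂ) :=
    (D.comp (LinearMap.fst ℂ _ _)).prod (g.comp (LinearMap.fst ℂ _ _) + LinearMap.snd ℂ _ _)
  have hDS : ∀ v, D (shift (p + 1) v) = shift (p + 1) (D v) := fun v =>
    (shift_s4Op (p + 2) α v).symm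
  have hD'S : ∀ v, D' (shift (p + 2) v) = shift (p + 2) (D' v) := fun v =>
    (shift_s4Op (p + 3) _ v).symm
  have hfD : ∀ v, f (D v) = g (shift (p + 1) v) + f v := fun v => by
    have := h.map_op v
    rw [neg_mul, one_mul, sub_neg_eq_add] at this
    exact this
  -- Both sides commute with the shift, the left one by the cocycle relation between f and g. Hence
  -- only e_2 has to be compared, and there the one new entry is a.
  have key : (T.toLinearMap ∘ₗ D₀ ∘ₗ T.symm.toLinearMap) = D' := by
    refine eq_of_commute_shift (fun w => ?_) hD'S ?_
    · obtain ⟨⟨v, t⟩, rfl⟩ := T.surjective w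
      simp only [LinearMap.comp_apply, LinearEquiv.coe_coe]
      rw [← hTS v t, LinearEquiv.symm_apply_apply, LinearEquiv.symm_apply_apply]
      change T (D (shift (p + 1) v), g (shift (p + 1) v) + f v) = shift (p + 2) (T (D v, g v + t))
      rw [← hTS, hDS, hfD]
    · have h0 : unitVec (p + 2) 2 = T (unitVec (p + 1) 2, 0) := by
        rw [hT, lower_unitVec_two, sub_zero, mul_zero, snocEquiv_unitVec _ _ (by omega)]
      simp only [LinearMap.comp_apply, LinearEquiv.coe_coe]
      rw [h0, LinearEquiv.symm_apply_apply, ← h0]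
      change T (D (unitVec (p + 1) 2), g (unitVec (p + 1) 2) + 0) = _
      rw [hT, add_zero]
      funext i
      have hr : D' (unitVec (p + 2) 2) i = _ :=
        s4Op_unitVec_two (p + 3) (Function.update α (p + 2) a) i
      rw [hr]
      refine Fin.lastCases ?_ (fun j => ?_) i
      · rw [snocEquiv_last, Fin.val_last, if_neg (by omega), if_neg (by omega),
          Function.update_self]
        exact ha'
      · have hl : D (unitVec (p + 1) 2) j = _ := s4Op_unitVec_two (p + 2) α j
        have hj := j.2
        rw [snocEquiv_castSucc, hl, Fin.val_castSucc, Function.update_of_ne (by omega)]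
  refine nonempty_equiv_s4 hψ hθ T hTS fun v t => ?_
  have h1 := LinearMap.congr_fun key (T (v, t))
  simp only [LinearMap.comp_apply, LinearEquiv.coe_coe, LinearEquiv.symm_apply_apply] at h1
  exact h1

/-- Every `𝔰⁴_{n+1,1}` extending the parameters is an extension with `γ = -1`. -/
theorem exists_isNonSplit_s4 {n : ℕ} (hn : 3 ≤ n) (α : ℕ → ℂ) (a : ℂ) :
    ∃ θ : S4 n α →ₗ⁅ℂ⁆ Module.End ℂ ℂ, nilradical (S4 n α) ≤ θ.ker ∧
      θ x = (-1 : ℂ) • LinearMap.id ∧ ∃ ψ : twoCocycle ℂ (S4 n α) (RepModule θ), IsNonSplit ψ ∧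
        Nonempty (LieAlgebra.ofTwoCocycle ψ ≃ₗ⁅ℂ⁆ S4 (n + 1) (Function.update α n a)) := by
  obtain ⟨p, rfl⟩ : ∃ p, n = p + 2 := ⟨n - 2, by omega⟩
  let D : Module.End ℂ (Fin (p + 1) → ℂ) := s4Op (p + 2) α
  let f : (Fin (p + 1) → ℂ) →ₗ[ℂ] ℂ := LinearMap.proj (Fin.last p)
  -- The cocycle condition is g∘S = f∘D - f. The right side vanishes on e_n, so `lower` solves it.
  -- The first coordinate vanishes on the image of S, so its coefficient a is free.
  let g : (Fin (p + 1) → ℂ) →ₗ[ℂ] ℂ := a • LinearMap.proj 0 + lower p (f ∘ₗ D - f)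
  have hlast : D (unitVec (p + 1) (p + 2)) = unitVec (p + 1) (p + 2) := by
    refine s4Op_of_shift_eq_zero (p + 2) α ?_
    exact (shift_unitVec (p + 1) _ (by omega)).trans (unitVec_eq_zero _ _ (by omega))
  have hgS : ∀ v, g (shift (p + 1) v) = f (D v) - f v := fun v => by
    simp only [g, LinearMap.add_apply, LinearMap.smul_apply, LinearMap.proj_apply,
      shift_apply_zero, lower_shift, LinearMap.sub_apply, LinearMap.comp_apply, hlast]
    simp
  have hdata : IsCocycleData (p + 2) α (-1) 0 f g :=
    { alt := fun _ => rfl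
      shift_left := fun _ _ => by simp
      op_left := fun _ _ => by simp
      map_op := fun v => by
        change f (D v) = g (shift (p + 1) v) - -1 * f v
        rw [hgS]
        ring }
  obtain ⟨θ, hN, hx, ψ, hψ⟩ := exists_twoCocycle (by omega) hdata
  have hf : f (unitVec (p + 1) (p + 2)) = 1 := by simp [f, unitVec]
  refine ⟨θ, hN, hx, ψ, (isNonSplit_iff hn hψ).2 fun v hS hv _ => ?_,
    nonempty_equiv_s4_update (by omega) hψ (fun u t => ?_) hdata (by rw [hf]; exact one_ne_zero) ?_⟩
  · have hS' : ∀ i : Fin p, (v : Fin (p + 1) → ℂ) i.castSucc = 0 := fun i =>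
      congrFun hS (i.succ : Fin (p + 1))
    funext i
    exact Fin.lastCases (motive := fun i => (v : Fin (p + 1) → ℂ) i = 0) hv hS' i
  · rw [rep_apply (by omega) hN, hx]
    simp
  · have hl : lower p f = 0 := by
      rw [lower]
      exact Finset.sum_eq_zero fun i _ => by simp [f, Fin.ext_iff, i.2.ne]
    have h2 : lower p (f ∘ₗ D - f) (unitVec (p + 1) 2) = 0 := lower_unitVec_two _ _
    rw [hf, hl]
    simp only [g, LinearMap.add_apply, LinearMap.smul_apply, h2]
    simp [unitVec]

end S4

end FiliformExt

/-! ### Normal form of alternating forms with skew shift. -/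

namespace FiliformExt

open LieModule.Cohomology Polynomial

/-- A complex polynomial with nonzero constant term has a square root modulo `X ^ (K + 1)`. -/
theorem exists_sq_sub_dvd (q : ℂ[X]) (hq : q.coeff 0 ≠ 0) (K : ℕ) :
    ∃ r : ℂ[X], r.coeff 0 ≠ 0 ∧ X ^ (K + 1) ∣ r ^ 2 - q := by
  induction K with
  | zero =>
    obtain ⟨z, hz⟩ := IsAlgClosed.exists_pow_nat_eq (q.coeff 0) (n := 2) (by norm_num)
    refine ⟨C z, ?_, ?_⟩
    · rw [coeff_C_zero]
      rintro rfl
      exact hq (by simpa using hz.symm)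
    · rw [zero_add, pow_one, X_dvd_iff, ← C_pow, coeff_sub, coeff_C_zero, hz, sub_self]
  | succ K ih =>
    obtain ⟨r, hr, s, hs⟩ := ih
    -- Newton step: the correction t solves s(0) + 2 t r(0) = 0, which kills the coefficient of
    -- X^(K+1) in the error.
    refine ⟨r + C (-s.coeff 0 / (2 * r.coeff 0)) * X ^ (K + 1), by simpa using hr, ?_⟩
    set t := -s.coeff 0 / (2 * r.coeff 0) with ht
    have h1 : (r + C t * X ^ (K + 1)) ^ 2 - q =
        X ^ (K + 1) * (s + C (2 * t) * r + C (t ^ 2) * X ^ (K + 1)) := by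
      rw [C_mul, C_pow, mul_add, mul_add, ← hs]
      simp only [map_ofNat]
      ring
    rw [h1, pow_succ]
    refine mul_dvd_mul_left _ ?_
    rw [X_dvd_iff]
    simp only [coeff_add, coeff_C_mul, coeff_X_pow]
    rw [if_neg (by omega), ht]
    field_simp
    ring

section SkewForms

variable {N : ℕ}

/-- The form `altForm N` as a bilinear map. -/
def altBilin (N : ℕ) : (Fin N → ℂ) →ₗ[ℂ] (Fin N → ℂ) →ₗ[ℂ] ℂ :=
  LinearMap.mk₂ ℂ (altForm N) (altForm_add_left N) (altForm_smul_left N) (altForm_add_right N)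
    (altForm_smul_right N)

@[simp] theorem altBilin_apply (v w : Fin N → ℂ) : altBilin N v w = altForm N v w := rfl

theorem apply_shift_pow_left {ω : (Fin N → ℂ) →ₗ[ℂ] (Fin N → ℂ) →ₗ[ℂ] ℂ}
    (h : ∀ v w, ω (shift N v) w = -ω v (shift N w)) (i : ℕ) (v w : Fin N → ℂ) :
    ω ((shift N ^ i) v) w = (-1) ^ i * ω v ((shift N ^ i) w) := by
  induction i generalizing v with
  | zero => simp
  | succ i ih =>
    rw [pow_succ, Module.End.mul_apply, ih, h, ← Module.End.mul_apply, ← pow_succ', ← pow_succ,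
      pow_succ (-1 : ℂ)]
    ring

/-- Forms for which the shift is skew are determined by their values on `e_2 × ⟨e_2, …⟩`. -/
theorem bilin_ext_of_shift_skew {ω ω' : (Fin N → ℂ) →ₗ[ℂ] (Fin N → ℂ) →ₗ[ℂ] ℂ}
    (h : ∀ v w, ω (shift N v) w = -ω v (shift N w))
    (h' : ∀ v w, ω' (shift N v) w = -ω' v (shift N w))
    (he : ∀ k, ω (unitVec N 2) ((shift N ^ k) (unitVec N 2)) =
      ω' (unitVec N 2) ((shift N ^ k) (unitVec N 2))) : ω = ω' := by
  refine linearMap_ext_unitVec fun i _ => linearMap_ext_unitVec fun j _ => ?_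
  rw [apply_shift_pow_left h, apply_shift_pow_left h', ← Module.End.mul_apply, ← pow_add, he]

theorem bilin_skew {ω : (Fin N → ℂ) →ₗ[ℂ] (Fin N → ℂ) →ₗ[ℂ] ℂ} (h : ∀ v, ω v v = 0)
    (v w : Fin N → ℂ) : ω v w = -ω w v := by
  have := h (v + w)
  simp only [map_add, LinearMap.add_apply, h] at this
  linear_combination this

theorem altForm_unitVec_two (N : ℕ) (w : Fin (N + 1) → ℂ) :
    altForm (N + 1) (unitVec (N + 1) 2) w = w (Fin.last N) := by
  rw [altForm, Finset.sum_eq_single 0]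
  · simp [unitVec]
  · intro k _ hk
    have hk' : (k : ℕ) ≠ 0 := fun h => hk (Fin.ext h)
    simp [unitVec, hk']
  · intro h
    exact absurd (Finset.mem_univ _) h

/-- The shift is skew, so its square, and hence every polynomial in the square, is self-adjoint. -/
theorem altForm_aeval (r : ℂ[X]) (v w : Fin N → ℂ) :
    altForm N (aeval (shift N ^ 2) r v) w = altForm N v (aeval (shift N ^ 2) r w) := by
  induction r using Polynomial.induction_on' with
  | add p q hp hq =>
    simp only [map_add, LinearMap.add_apply, altForm_add_left, altForm_add_right, hp, hq]
  | monomial i a =>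
    rw [aeval_monomial, ← Algebra.smul_def, LinearMap.smul_apply, LinearMap.smul_apply,
      altForm_smul_left, altForm_smul_right, ← pow_mul, altForm_shift_pow, pow_mul, neg_one_sq,
      one_pow, one_mul]

theorem commute_aeval_shift (r : ℂ[X]) : Commute (aeval (shift N ^ 2) r) (shift N) := by
  induction r using Polynomial.induction_on' with
  | add p q hp hq =>
    rw [map_add]
    exact hp.add_left hq
  | monomial i a =>
    rw [aeval_monomial, ← Algebra.smul_def, ← pow_mul]
    exact ((Commute.refl _).pow_left _).smul_left _

theorem isUnit_aeval_shift {r : ℂ[X]} (hr : r.coeff 0 ≠ 0) : IsUnit (aeval (shift N ^ 2) r) := by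
  have h : aeval (shift N ^ 2) r = r.coeff 0 • (1 : Module.End ℂ (Fin N → ℂ)) +
      ∑ i ∈ Finset.range r.natDegree, r.coeff (i + 1) • shift N ^ (2 * (i + 1)) := by
    rw [aeval_eq_sum_range, Finset.sum_range_succ', add_comm]
    simp only [pow_zero, ← pow_mul]
  rw [h]
  exact isUnit_smul_one_add_sum hr _ (fun i => r.coeff (i + 1)) (fun i => 2 * (i + 1))
    fun i _ => by omega

/-- A nondegenerate alternating form for which the shift is skew becomes the standard one after
an operator commuting with the shift. -/
theorem exists_isUnit_altForm_eq (hN : Odd N)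
    {ω : (Fin (N + 1) → ℂ) →ₗ[ℂ] (Fin (N + 1) → ℂ) →ₗ[ℂ] ℂ} (halt : ∀ v, ω v v = 0)
    (hskew : ∀ v w, ω (shift (N + 1) v) w = -ω v (shift (N + 1) w))
    (hne : ω (unitVec (N + 1) 2) ((shift (N + 1) ^ N) (unitVec (N + 1) 2)) ≠ 0) :
    ∃ R : Module.End ℂ (Fin (N + 1) → ℂ), IsUnit R ∧ Commute R (shift (N + 1)) ∧
      ∀ v w, altForm (N + 1) (R v) (R w) = ω v w := by
  set e := unitVec (N + 1) 2 with he
  set S := shift (N + 1) with hS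
  set h : ℕ → ℂ := fun k => ω e ((S ^ k) e) with hh
  -- For even k the power S^k is self-adjoint for ω, so ω(e, S^k e) is both symmetric and
  -- alternating.
  have heven : ∀ k, Even k → h k = 0 := by
    intro k hk
    have h1 := apply_shift_pow_left hskew k e e
    rw [hk.neg_one_pow, one_mul, bilin_skew halt] at h1
    change -h k = h k at h1
    linear_combination (-1 / 2 : ℂ) * h1
  have hbig : ∀ k, N < k → h k = 0 := by
    intro k hk
    have h1 : (S ^ k) e = 0 := by
      rw [he, hS, shift_pow_unitVec _ _ _ le_rfl, unitVec_eq_zero _ _ (by omega)]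
    simp only [hh]
    rw [h1, map_zero]
  -- Pairing e_2 with S^(2l+k) e_2 in the standard form gives 1 exactly when 2l + k = N. Thus q(S²)
  -- reproduces h(k) when its l-th coefficient is h(N - 2l). As N is odd, this covers all odd k ≤ N.
  let b : ℕ → ℂ := fun l => if 2 * l ≤ N then h (N - 2 * l) else 0
  let q : ℂ[X] := ∑ l ∈ Finset.range (N + 1), monomial l (b l)
  have hq0 : q.coeff 0 = h N := by
    simp only [q, finsetSum_coeff, coeff_monomial]
    rw [Finset.sum_ite_eq' (Finset.range (N + 1)) 0 b]
    simp [b]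
  -- Precision X^(N+1) suffices because S^(N+1) = 0, so the error vanishes at S².
  obtain ⟨r, hr0, s, hs⟩ := exists_sq_sub_dvd q (by rw [hq0]; exact hne) N
  have hR2 : aeval (S ^ 2) r * aeval (S ^ 2) r = aeval (S ^ 2) q := by
    rw [← map_mul, ← sq, sub_eq_iff_eq_add.1 hs, map_add, map_mul, map_pow, aeval_X, ← pow_mul,
      mul_comm 2, pow_mul, hS, shift_pow_self]
    simp
  refine ⟨aeval (S ^ 2) r, isUnit_aeval_shift hr0, commute_aeval_shift r, fun v w => ?_⟩
  rw [altForm_aeval, ← Module.End.mul_apply, hR2]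
  have hcomm : ∀ v, aeval (S ^ 2) q (S v) = S (aeval (S ^ 2) q v) := fun v =>
    LinearMap.congr_fun (commute_aeval_shift q).eq v
  have key : (altBilin (N + 1)).compl₂ (aeval (S ^ 2) q) = ω := by
    refine bilin_ext_of_shift_skew (fun v w => ?_) hskew fun k => ?_
    · rw [LinearMap.compl₂_apply, LinearMap.compl₂_apply, altBilin_apply, altBilin_apply, hcomm,
        altForm_shift]
    · rw [LinearMap.compl₂_apply, altBilin_apply, altForm_unitVec_two, ← he, ← hS]
      change _ = h k
      simp only [q, map_sum, aeval_monomial, ← Algebra.smul_def, LinearMap.sum_apply,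
        LinearMap.smul_apply, Finset.sum_apply, Pi.smul_apply, ← pow_mul, smul_eq_mul]
      have hterm : ∀ l, (S ^ (2 * l)) ((S ^ k) e) (Fin.last N) =
          if N + 2 = 2 + (2 * l + k) then 1 else 0 := fun l => by
        rw [← Module.End.mul_apply, ← pow_add, he, hS, shift_pow_unitVec _ _ _ le_rfl]
        rfl
      simp only [hterm]
      by_cases hk : Odd k ∧ k ≤ N
      · obtain ⟨i, hi⟩ := hk.1
        obtain ⟨j, hj⟩ := hN
        rw [Finset.sum_eq_single (j - i)]
        · simp only [b]
          rw [if_pos (by omega), if_pos (by omega), mul_one]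
          congr 1
          omega
        · intro l _ hl
          rw [if_neg (by omega), mul_zero]
        · intro hl
          rw [Finset.mem_range] at hl
          omega
      · have hk0 : h k = 0 := by
          by_cases h1 : Odd k
          · exact hbig k (by by_contra h2; exact hk ⟨h1, by omega⟩)
          · exact heven k (Nat.not_odd_iff_even.1 h1)
        rw [hk0]
        refine Finset.sum_eq_zero fun l _ => ?_
        rw [if_neg, mul_zero]
        intro h1
        refine hk ⟨?_, by omega⟩
        rw [Nat.odd_iff] at hN ⊢
        omega
  exact LinearMap.congr_fun₂ key v w

end SkewForms

/-! ### Constraints on γ, n and the parameters. -/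

namespace S4

variable {n : ℕ} {α : ℕ → ℂ} {γ : ℂ}
  {ω : (Fin (n - 1) → ℂ) →ₗ[ℂ] (Fin (n - 1) → ℂ) →ₗ[ℂ] ℂ} {f g : (Fin (n - 1) → ℂ) →ₗ[ℂ] ℂ}

/-- Skewness moves S^(j-1) across ω at the cost of (-1)^(j-1). The condition on D then becomes one
operator in the second argument, with only the even powers of S surviving. -/
theorem IsCocycleData.apply_sum_eq_zero (h : IsCocycleData n α γ ω f g) (v w : Fin (n - 1) → ℂ) :
    ω v (((2 + γ) • (1 : Module.End ℂ (Fin (n - 1) → ℂ)) + ∑ j ∈ Finset.Icc 3 (n - 1),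
      (α j * (1 + (-1) ^ (j - 1))) • shift (n - 1) ^ (j - 1)) w) = 0 := by
  have h1 := h.op_left v w
  simp only [s4Op, LinearMap.add_apply, LinearMap.sum_apply, LinearMap.smul_apply,
    Module.End.one_apply, map_add, map_sum, map_smul, smul_eq_mul,
    apply_shift_pow_left h.shift_left] at h1 ⊢
  have h2 : ∑ j ∈ Finset.Icc 3 (n - 1),
      α j * (1 + (-1) ^ (j - 1)) * ω v ((shift (n - 1) ^ (j - 1)) w) =
      ∑ j ∈ Finset.Icc 3 (n - 1), α j * ω v ((shift (n - 1) ^ (j - 1)) w) +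
      ∑ j ∈ Finset.Icc 3 (n - 1), α j * ((-1) ^ (j - 1) * ω v ((shift (n - 1) ^ (j - 1)) w)) := by
    rw [← Finset.sum_add_distrib]
    exact Finset.sum_congr rfl fun j _ => by ring
  rw [h2]
  linear_combination h1

theorem IsCocycleData.eq_zero (h : IsCocycleData n α γ ω f g) (hγ : γ ≠ -2) : ω = 0 := by
  have hu := isUnit_smul_one_add_sum (N := n - 1) (c := 2 + γ)
    (fun h0 => hγ (by linear_combination h0)) (Finset.Icc 3 (n - 1))
    (fun j => α j * (1 + (-1) ^ (j - 1))) (fun j => j - 1) fun j hj => by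
      rw [Finset.mem_Icc] at hj
      omega
  refine LinearMap.ext₂ fun v w => ?_
  obtain ⟨w, rfl⟩ := ((Module.End.isUnit_iff _).1 hu).2 w
  exact h.apply_sum_eq_zero v w

theorem shift_unitVec_last (hn : 2 ≤ n) : shift (n - 1) (unitVec (n - 1) n) = 0 := by
  rw [shift_unitVec _ _ hn, unitVec_eq_zero _ _ (by omega)]

theorem unitVec_last_ne_zero (hn : 2 ≤ n) : unitVec (n - 1) n ≠ 0 := by
  intro h
  have h1 := congrFun h ⟨n - 2, by omega⟩
  simp only [unitVec, Pi.zero_apply] at h1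
  rw [if_pos (by omega)] at h1
  exact one_ne_zero h1

/-- Evaluate everything on e_n, where S vanishes and D is the identity: f(e_n) = -γ f(e_n), while ω
is zero unless γ = -2. -/
theorem IsCocycleData.dichotomy (hn : 2 ≤ n) (h : IsCocycleData n α γ ω f g)
    (hns : ∀ v, shift (n - 1) v = 0 → f v = 0 → ω v = 0 → v = 0) :
    (γ = -1 ∧ ω = 0 ∧ f (unitVec (n - 1) n) ≠ 0) ∨ (γ = -2 ∧ ω (unitVec (n - 1) n) ≠ 0) := by
  have hS := shift_unitVec_last hn
  by_cases hf : f (unitVec (n - 1) n) = 0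
  · have hω : ω (unitVec (n - 1) n) ≠ 0 := fun hω =>
      unitVec_last_ne_zero hn (hns _ hS hf hω)
    refine Or.inr ⟨?_, hω⟩
    by_contra hγ
    exact hω (by rw [h.eq_zero hγ, LinearMap.zero_apply])
  · have h1 := h.map_op (unitVec (n - 1) n)
    rw [s4Op_of_shift_eq_zero _ _ hS, hS, map_zero] at h1
    have hγ : γ = -1 := mul_right_cancel₀ hf (by linear_combination h1)
    refine Or.inl ⟨hγ, h.eq_zero ?_, hf⟩
    rw [hγ]
    norm_num

theorem IsCocycleData.odd_and_apply_ne_zero (hn : 3 ≤ n) (h : IsCocycleData n α γ ω f g)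
    (hω : ω (unitVec (n - 1) n) ≠ 0) :
    Odd n ∧ ω (unitVec (n - 1) 2) ((shift (n - 1) ^ (n - 2)) (unitVec (n - 1) 2)) ≠ 0 := by
  have hlast : (shift (n - 1) ^ (n - 2)) (unitVec (n - 1) 2) = unitVec (n - 1) n := by
    rw [shift_pow_unitVec _ _ _ le_rfl]
    congr 1
    omega
  -- Since ω(e_n, Sw) = -ω(S e_n, w) = 0, the only possible nonzero value of ω(e_n, ·) on the basis
  -- is at e_2.
  have h0 : ω (unitVec (n - 1) n) (unitVec (n - 1) 2) ≠ 0 := by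
    intro h0
    refine hω (linearMap_ext_unitVec fun i _ => ?_)
    cases i with
    | zero => simpa using h0
    | succ i =>
      rw [pow_succ', Module.End.mul_apply, ← neg_eq_iff_eq_neg.2 (h.shift_left _ _),
        shift_unitVec_last (by omega)]
      simp
  have h1 := apply_shift_pow_left h.shift_left (n - 2) (unitVec (n - 1) 2) (unitVec (n - 1) 2)
  rw [hlast, bilin_skew h.alt (unitVec (n - 1) 2)] at h1
  rw [hlast, bilin_skew h.alt]
  refine ⟨?_, neg_ne_zero.2 h0⟩
  by_contra hodd
  -- For n even, S^(n-2) is self-adjoint for ω, so ω(e_2, e_n) = ω(e_n, e_2). Alternation then makes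
  -- it zero.
  have he : Even (n - 2) := by
    rw [Nat.not_odd_iff_even, Nat.even_iff] at hodd
    rw [Nat.even_iff]
    omega
  rw [he.neg_one_pow] at h1
  exact h0 (by linear_combination (1 / 2 : ℂ) * h1)

theorem IsCocycleData.odd_coeff_eq_zero (h : IsCocycleData n α (-2) ω f g)
    (hω : ω (unitVec (n - 1) n) ≠ 0) (t : ℕ) (ht : 2 ≤ t) (htn : 2 * t - 1 ≤ n - 1) :
    α (2 * t - 1) = 0 := by
  induction t using Nat.strong_induction_on with
  | _ t ih =>
    by_contra hα
    refine hω (LinearMap.ext fun v => ?_)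
    -- This basis vector is chosen so that S^(2t-2) sends it to e_n and higher powers kill it. Even
    -- j drop out by sign and smaller odd j by induction, leaving 2 α_{2t-1} ω(v, e_n) = 0.
    have h1 := h.apply_sum_eq_zero v (unitVec (n - 1) (n - (2 * t - 2)))
    rw [add_neg_cancel, zero_smul, zero_add, LinearMap.sum_apply,
      Finset.sum_eq_single (2 * t - 1)] at h1
    · have h2 : Even (2 * t - 1 - 1) := by
        rw [Nat.even_iff]
        omega
      have h3 : n - (2 * t - 2) + (2 * t - 1 - 1) = n := by omega
      rw [LinearMap.smul_apply, shift_pow_unitVec _ _ _ (by omega), h3, h2.neg_one_pow, map_smul,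
        smul_eq_mul, bilin_skew h.alt] at h1
      have h4 := (mul_eq_zero.1 h1).resolve_left (mul_ne_zero hα (by norm_num))
      exact neg_eq_zero.1 h4
    · intro j hj hne
      rw [Finset.mem_Icc] at hj
      rw [LinearMap.smul_apply]
      rcases lt_or_gt_of_ne hne with hlt | hgt
      · rcases Nat.even_or_odd j with he | ho
        · have h2 : Odd (j - 1) := by
            rw [Nat.even_iff] at he
            rw [Nat.odd_iff]
            omega
          rw [h2.neg_one_pow, add_neg_cancel, mul_zero, zero_smul]
        · obtain ⟨i, hi⟩ := ho
          have h2 := ih (i + 1) (by omega) (by omega) (by omega)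
          rw [show 2 * (i + 1) - 1 = j by omega] at h2
          rw [h2, zero_mul, zero_smul]
      · rw [shift_pow_unitVec _ _ _ (by omega), unitVec_eq_zero _ _ (by omega), smul_zero]
    · intro hj
      rw [Finset.mem_Icc] at hj
      omega

end S4

end FiliformExt

/-! ### Extensions with γ = -2. -/

namespace FiliformExt

open LieModule.Cohomology

/-- The operator of τ³ contains only odd powers of the shift, that is, even-index parameters.
Vanishing of the odd-index ones is precisely what makes it agree with D. -/
theorem tauOp_eq_s4Op (p : ℕ) {α : ℕ → ℂ}
    (hα : ∀ t, 2 ≤ t → 2 * t - 1 ≤ 2 * p + 2 → α (2 * t - 1) = 0) :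
    (tauOp (p + 2) α : Module.End ℂ (Fin (2 * p + 2) → ℂ)) = s4Op (2 * p + 3) α := by
  change (1 : Module.End ℂ (Fin (2 * p + 2) → ℂ)) + ∑ k ∈ Finset.Icc 2 (p + 1),
      α (2 * k) • shift (2 * p + 2) ^ (2 * k - 1) =
    1 + ∑ j ∈ Finset.Icc 3 (2 * p + 2), α j • shift (2 * p + 2) ^ (j - 1)
  congr 1
  refine Finset.sum_bij_ne_zero (fun k _ _ => 2 * k) ?_ ?_ ?_ ?_
  · intro k hk _
    rw [Finset.mem_Icc] at hk ⊢
    omega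
  · intro k _ _ l _ _ h
    omega
  · intro j hj h0
    rw [Finset.mem_Icc] at hj
    rcases Nat.even_or_odd' j with ⟨i, rfl | rfl⟩
    · exact ⟨i, Finset.mem_Icc.2 (by omega), h0, rfl⟩
    · refine absurd ?_ h0
      have h1 := hα (i + 1) (by omega) (by omega)
      rw [show 2 * (i + 1) - 1 = 2 * i + 1 by omega] at h1
      rw [h1, zero_smul]
  · intro k _ _
    rfl

/-- Nondegeneracy: pairing with the reversed basis vector reads off a coordinate up to sign. It
makes the τ³ cocycle non-split. -/
theorem eq_zero_of_altForm_eq_zero {N : ℕ} {v : Fin N → ℂ} (h : ∀ w, altForm N v w = 0) :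
    v = 0 := by
  funext i
  have h1 := h (Pi.single (Fin.rev i) 1)
  rw [altForm, Finset.sum_eq_single i (fun k _ hk => ?_)
    fun hi => absurd (Finset.mem_univ _) hi] at h1
  · rw [Pi.single_eq_same, mul_one] at h1
    exact (mul_eq_zero.1 h1).resolve_left (pow_ne_zero _ (by norm_num))
  · rw [Pi.single_eq_of_ne (fun h2 => hk (Fin.rev_injective h2)), mul_zero]

namespace S4

variable {n : ℕ} {α : ℕ → ℂ}

/-- After subtracting a coboundary, a cocycle with `γ = -2` has `f = g = 0`. -/
theorem IsCocycleData.exists_primitive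
    {ω : (Fin (n - 1) → ℂ) →ₗ[ℂ] (Fin (n - 1) → ℂ) →ₗ[ℂ] ℂ} {f g : (Fin (n - 1) → ℂ) →ₗ[ℂ] ℂ}
    (h : IsCocycleData n α (-2) ω f g) :
    ∃ φ : (Fin (n - 1) → ℂ) →ₗ[ℂ] ℂ, (∀ v, φ (shift (n - 1) v) = f v) ∧
      ∀ v, φ (s4Op n α v) = g v + 2 * φ v := by
  -- D - 2 is -1 plus a nilpotent, so φ = g∘(D - 2)⁻¹ meets the second condition. The first follows
  -- from f∘(D - 2) = g∘S, because S commutes with D.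
  have hu : IsUnit (s4Op n α - (2 : ℂ) • 1) := by
    have h1 := isUnit_smul_one_add_sum (N := n - 1) (c := -1) (by norm_num) (Finset.Icc 3 (n - 1))
      α (fun j => j - 1) fun j hj => by
        rw [Finset.mem_Icc] at hj
        omega
    have h2 : s4Op n α - (2 : ℂ) • 1 = (-1 : ℂ) • (1 : Module.End ℂ (Fin (n - 1) → ℂ)) +
        ∑ j ∈ Finset.Icc 3 (n - 1), α j • shift (n - 1) ^ (j - 1) := by
      rw [s4Op]
      module
    rwa [h2]
  obtain ⟨U, hU⟩ := hu
  have hUv : ∀ v, (U : Module.End ℂ (Fin (n - 1) → ℂ)) v = s4Op n α v - (2 : ℂ) • v := fun v => by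
    rw [hU, LinearMap.sub_apply, LinearMap.smul_apply, Module.End.one_apply]
  have hinv : ∀ v, (↑U⁻¹ : Module.End ℂ (Fin (n - 1) → ℂ))
      ((U : Module.End ℂ (Fin (n - 1) → ℂ)) v) = v := fun v => by
    rw [← Module.End.mul_apply, Units.inv_mul, Module.End.one_apply]
  have hsurj : ∀ v, ∃ w, (U : Module.End ℂ (Fin (n - 1) → ℂ)) w = v := fun v =>
    ⟨(↑U⁻¹ : Module.End ℂ (Fin (n - 1) → ℂ)) v, by
      rw [← Module.End.mul_apply, Units.mul_inv, Module.End.one_apply]⟩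
  refine ⟨g ∘ₗ (↑U⁻¹ : Module.End ℂ (Fin (n - 1) → ℂ)), fun v => ?_, fun v => ?_⟩
  · obtain ⟨w, rfl⟩ := hsurj v
    have h1 : shift (n - 1) ((U : Module.End ℂ (Fin (n - 1) → ℂ)) w) =
        (U : Module.End ℂ (Fin (n - 1) → ℂ)) (shift (n - 1) w) := by
      rw [hUv, hUv, map_sub, map_smul, shift_s4Op]
    rw [h1, LinearMap.comp_apply, hinv, hUv, map_sub, map_smul, h.map_op, smul_eq_mul]
    ring
  · have h1 : s4Op n α v = (U : Module.End ℂ (Fin (n - 1) → ℂ)) v + (2 : ℂ) • v := by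
      rw [hUv, sub_add_cancel]
    rw [h1, map_add, map_smul, LinearMap.comp_apply, hinv, smul_eq_mul]

/-- Extensions with `γ = -2` and `ω(e_n, -) ≠ 0`. -/
theorem nonempty_equiv_tau3_of_ne_zero (hn : 3 ≤ n) {θ : S4 n α →ₗ⁅ℂ⁆ Module.End ℂ ℂ}
    {ψ : twoCocycle ℂ (S4 n α) (RepModule θ)}
    {ω : (Fin (n - 1) → ℂ) →ₗ[ℂ] (Fin (n - 1) → ℂ) →ₗ[ℂ] ℂ} {f g : (Fin (n - 1) → ℂ) →ₗ[ℂ] ℂ}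
    {c : ℂ} (hψ : ∀ u w, RepModule.toComplex θ (ψ.1 u w) = form ω f g c u w)
    (hθ : ∀ u t, θ u t = -2 * u.cx * t) (h : IsCocycleData n α (-2) ω f g)
    (hω : ω (unitVec (n - 1) n) ≠ 0) :
    Nonempty (LieAlgebra.ofTwoCocycle ψ ≃ₗ⁅ℂ⁆ Tau3 ((n + 1) / 2) α) := by
  obtain ⟨hodd, hne⟩ := h.odd_and_apply_ne_zero hn hω
  have hα := h.odd_coeff_eq_zero hω
  obtain ⟨φ, hφS, hφD⟩ := h.exists_primitive
  obtain ⟨p, rfl⟩ : ∃ p, n = 2 * p + 3 := by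
    obtain ⟨k, hk⟩ := hodd
    exact ⟨k - 1, by omega⟩
  rw [show (2 * p + 3 + 1) / 2 = p + 2 by omega]
  obtain ⟨R, hR, hRS, hRω⟩ := exists_isUnit_altForm_eq (N := 2 * p + 1) ⟨p, rfl⟩ h.alt
    h.shift_left hne
  have hbij := (Module.End.isUnit_iff _).1 hR
  have hRD : Commute R (s4Op (2 * p + 3) α) :=
    (Commute.one_right _).add_right
      (Commute.sum_right _ _ _ fun j _ => (hRS.pow_right _).smul_right _)
  refine nonempty_equiv_tau3 hψ hθ (m := p + 2) (LinearEquiv.ofBijective R hbij) φ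
    (fun v => LinearMap.congr_fun hRS.eq v) (fun v => ?_) hRω hφS hφD
  refine (LinearMap.congr_fun hRD.eq v).trans ?_
  exact (LinearMap.congr_fun (tauOp_eq_s4Op p hα) (R v)).symm

/-- The algebra `τ³_{n+1,1}` is an extension with `γ = -2`. -/
theorem exists_isNonSplit_tau3 (hn : 3 ≤ n) (hodd : Odd n)
    (hα : ∀ t : ℕ, 2 ≤ t → 2 * t - 1 ≤ n - 1 → α (2 * t - 1) = 0) :
    ∃ θ : S4 n α →ₗ⁅ℂ⁆ Module.End ℂ ℂ, nilradical (S4 n α) ≤ θ.ker ∧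
      θ x = (-2 : ℂ) • LinearMap.id ∧ ∃ ψ : twoCocycle ℂ (S4 n α) (RepModule θ), IsNonSplit ψ ∧
        Nonempty (LieAlgebra.ofTwoCocycle ψ ≃ₗ⁅ℂ⁆ Tau3 ((n + 1) / 2) α) := by
  obtain ⟨p, rfl⟩ : ∃ p, n = 2 * p + 3 := by
    obtain ⟨k, hk⟩ := hodd
    exact ⟨k - 1, by omega⟩
  rw [show (2 * p + 3 + 1) / 2 = p + 2 by omega]
  have hop : ∀ v w, altForm (2 * p + 2) (s4Op (2 * p + 3) α v) w =
      2 * altForm (2 * p + 2) v w - altForm (2 * p + 2) v (s4Op (2 * p + 3) α w) := by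
    intro v w
    have h1 := altForm_tauOp (p + 2) α v w
    have h2 : tauOp (p + 2) α = s4Op (2 * p + 3) α := tauOp_eq_s4Op p hα
    rw [h2] at h1
    exact h1
  have hdata : IsCocycleData (2 * p + 3) α (-2) (altBilin (2 * p + 2)) 0 0 :=
    { alt := fun v => by
        have h1 : altForm (2 * p + 2) v v = -altForm (2 * p + 2) v v := altForm_swap (p + 2) v v
        change altForm (2 * p + 2) v v = 0
        linear_combination (1 / 2 : ℂ) * h1
      shift_left := altForm_shift (2 * p + 2)
      op_left := fun v w => by
        refine (hop v w).trans ?_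
        rw [neg_neg]
        rfl
      map_op := fun v => by simp }
  obtain ⟨θ, hN, hx, ψ, hψ⟩ := exists_twoCocycle (by omega) hdata
  refine ⟨θ, hN, hx, ψ, (isNonSplit_iff hn hψ).2 fun v _ _ hv => ?_,
    nonempty_equiv_tau3 hψ (fun u t => ?_) (m := p + 2) (LinearEquiv.refl ℂ _) 0 (fun _ => rfl)
      (fun v => ?_) (fun _ _ => rfl) (fun _ => rfl) (fun v => by simp)⟩
  · exact eq_zero_of_altForm_eq_zero fun w => LinearMap.congr_fun hv w
  · rw [rep_apply (by omega) hN, hx]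
    simp
  · exact (LinearMap.congr_fun (tauOp_eq_s4Op p hα) v).symm

end S4

end FiliformExt

end

theorem mainTheorem7 (n : ℕ) (hn : 3 ≤ n) (α : ℕ → ℂ) :
    -- every non-split extension `L(ψ, θ)` is one of the listed algebras
    (∀ θ : FiliformExt.S4 n α →ₗ⁅ℂ⁆ Module.End ℂ ℂ,
      FiliformExt.nilradical (FiliformExt.S4 n α) ≤ θ.ker →
      ∀ ψ : LieModule.Cohomology.twoCocycle ℂ (FiliformExt.S4 n α) (FiliformExt.RepModule θ),
      FiliformExt.IsNonSplit ψ →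
        (θ FiliformExt.S4.x = (-1 : ℂ) • LinearMap.id ∧
          ∃ a : ℂ, Nonempty (LieAlgebra.ofTwoCocycle ψ ≃ₗ⁅ℂ⁆
            FiliformExt.S4 (n + 1) (Function.update α n a))) ∨
        (θ FiliformExt.S4.x = (-2 : ℂ) • LinearMap.id ∧ Odd n ∧
          (∀ t : ℕ, 2 ≤ t → 2 * t - 1 ≤ n - 1 → α (2 * t - 1) = 0) ∧
          Nonempty (LieAlgebra.ofTwoCocycle ψ ≃ₗ⁅ℂ⁆ FiliformExt.Tau3 ((n + 1) / 2) α))) ∧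
    -- every algebra `𝔰⁴_{n+1,1}(α₃, …, α_{n-1}, a)` arises, with `γ = -1`
    (∀ a : ℂ, ∃ θ : FiliformExt.S4 n α →ₗ⁅ℂ⁆ Module.End ℂ ℂ,
      FiliformExt.nilradical (FiliformExt.S4 n α) ≤ θ.ker ∧ θ FiliformExt.S4.x = (-1 : ℂ) • LinearMap.id ∧
      ∃ ψ : LieModule.Cohomology.twoCocycle ℂ (FiliformExt.S4 n α) (FiliformExt.RepModule θ),
        FiliformExt.IsNonSplit ψ ∧
        Nonempty (LieAlgebra.ofTwoCocycle ψ ≃ₗ⁅ℂ⁆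
          FiliformExt.S4 (n + 1) (Function.update α n a))) ∧
    -- the algebra `τ³_{n+1,1}(α₄, α₆, …, α_{n-1})` arises, with `γ = -2`
    (Odd n → (∀ t : ℕ, 2 ≤ t → 2 * t - 1 ≤ n - 1 → α (2 * t - 1) = 0) →
      ∃ θ : FiliformExt.S4 n α →ₗ⁅ℂ⁆ Module.End ℂ ℂ,
      FiliformExt.nilradical (FiliformExt.S4 n α) ≤ θ.ker ∧ θ FiliformExt.S4.x = (-2 : ℂ) • LinearMap.id ∧
      ∃ ψ : LieModule.Cohomology.twoCocycle ℂ (FiliformExt.S4 n α) (FiliformExt.RepModule θ),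
        FiliformExt.IsNonSplit ψ ∧
        Nonempty (LieAlgebra.ofTwoCocycle ψ ≃ₗ⁅ℂ⁆ FiliformExt.Tau3 ((n + 1) / 2) α)) := by
  refine ⟨fun θ hθ ψ hψ => ?_, FiliformExt.S4.exists_isNonSplit_s4 hn α,
    FiliformExt.S4.exists_isNonSplit_tau3 hn⟩
  obtain ⟨ω, f, g, c, hdata, hform⟩ := FiliformExt.S4.exists_form (by omega) hθ ψ
  have hrep := FiliformExt.S4.rep_apply (by omega) hθ
  have hx : ∀ γ : ℂ, θ FiliformExt.S4.x 1 = γ → θ FiliformExt.S4.x = γ • LinearMap.id := by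
    intro γ hγ
    refine LinearMap.ext fun t => ?_
    rw [hrep, hγ]
    simp
  rcases hdata.dichotomy (by omega) ((FiliformExt.S4.isNonSplit_iff hn hform).1 hψ) with
    ⟨hγ, hω, hf⟩ | ⟨hγ, hω⟩
  · rw [hγ] at hdata hrep
    subst hω
    refine Or.inl ⟨hx _ hγ, ?_⟩
    obtain ⟨p, rfl⟩ : ∃ p, n = p + 2 := ⟨n - 2, by omega⟩
    -- The new parameter is a = (g(e_2) - μ(D e_2)) / f(e_n) with μ = `lower p f`; unification reads
    -- it off from the division identity.
    exact ⟨_, FiliformExt.S4.nonempty_equiv_s4_update (by omega) hform hrep hdata hf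
      (mul_div_cancel₀ _ hf)⟩
  · rw [hγ] at hdata hrep
    exact Or.inr ⟨hx _ hγ, (hdata.odd_and_apply_ne_zero hn hω).1, hdata.odd_coeff_eq_zero hω,
      FiliformExt.S4.nonempty_equiv_tau3_of_ne_zero hn hform hrep hdata hω⟩
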